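/- Let $G$ be a locally compact (Hausdorff) group with left Haar measure $m$, let $C_b(G)$ be the algebra of bounded continuous complex functions on $G$, $\mathcal K(G)$ its subspace of functions with compact support, $\mathcal K_+(G)$ the cone of nonnegative functions in $\mathcal K(G)$, and let $(\Delta f)(p,q)=f(pq)$, $\check f(p)=f(p^{-1})$. Let $P\colon C_b(G)\to C_b(G)$ be a conditional expectation, that is, a linear idempotent of norm one whose range is a C*-subalgebra, with $P(f^*f)\ge 0$, $P(b_1fb_2)=b_1P(f)b_2$ for $b_1,b_2$ in the range of $P$, and $P(f)^*P(f)\le P(f^*f)$. Assume that $P$ maps $\mathcal K_+(G)$ to itself, that $f(p)>0$ implies $(Pf)(p)>0$ for $f\in\mathcal K_+(G)$ and $p\in G$, that $$(P\times \mathrm{id})\,\Delta\, P=(\mathrm{id}\times P)\,\Delta\, P=(P\times P)\,\Delta,\qquad P(\check f)=(Pf)\check{\ }\qquad (f\in C_b(G)),$$ and that $\int_G Pf\,dm=\int_G f\,dm$ for $f\in\mathcal K(G)$. Let $Q$ be the spectrum of the commutative C*-algebra $B=P(C_0(G))$, let $\varphi\colon G\to Q$ be the map $\varphi(p)(b)=b(p)$,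 put $\check s(b)=s(\check b)$ for $s\in Q$, $b\in B$, and let $\tilde\Delta\colon C_b(Q)\to C_b(Q\times Q)$ be the map $\tilde\Delta=(P\times P)\Delta$ under the identification of a function $f$ on $Q$ with the function $f\circ\varphi$ on $G$. The space $M_b(Q)$ of bounded complex Radon measures on $Q$ is a $*$-algebra for $$\langle f,\mu*\nu\rangle=\int_Q\int_Q(\tilde\Delta f)(s,t)\,d\mu(s)\,d\nu(t),\qquad \langle f,\mu^\star\rangle=\overline{\int_Q\overline{f(\check s)}\,d\mu(s)} .$$ Let $\tilde m=\varphi_*m$, let $L_1(\tilde m)=\{f\tilde m : f\in L_1(Q,\tilde m)\}\subset M_b(Q)$ and $L_2(Q)=L_2(Q,\tilde m)$. For $s\in Q$ let $\lambda_Q(\varepsilon_s)$ be the contraction on $L_2(Q)$ obtained by continuity from $(\lambda_Q(\varepsilon_s)f)(t)=(\tilde\Delta f)(\check s,t)$, $f\in\mathcal K(Q)$. Define, as weak integrals, $$\lambda_Q(\mu)=\int_Q\lambda_Q(\varepsilon_s)\,d\mu(s)\quad(\mu\in M_b(Q)),\qquad (\lambda_Q\otimes\lambda_Q)(\nu)=\int_{Q\times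 Q}\lambda_Q(\varepsilon_s)\otimes\lambda_Q(\varepsilon_t)\,d\nu(s,t)\quad(\nu\in M_b(Q\times Q)),$$ so that $(\lambda_Q\otimes\lambda_Q)(\mu\otimes\nu)=\lambda_Q(\mu)\otimes\lambda_Q(\nu)$. Finally let $\delta\colon M_b(Q)\to M_b(Q\times Q)$ be given by $\langle F,\delta(\mu)\rangle=\int_QF(s,s)\,d\mu(s)$, so that $\delta(\varepsilon_s)=\varepsilon_s\otimes\varepsilon_s$. Then the linear map $\Phi=(\lambda_Q\otimes\lambda_Q)\circ\delta\colon L_1(\tilde m)\to B(L_2(Q)\otimes L_2(Q))$ is completely positive: for every $n$ and every matrix $M\in\mathrm{Mat}_n(L_1(\tilde m))$, the element $(\mathrm{id}\otimes\Phi)(M^\star M)$ of the C*-algebra $\mathrm{Mat}_n\bigl(B(L_2(Q)\otimes L_2(Q))\bigr)$ is positive. -/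

import Mathlib

noncomputable section

namespace ExpectationHypergroup

open scoped BoundedContinuousFunction ZeroAtInfty ComplexOrder InnerProductSpace TensorProduct
  Topology

/-! ### Conditional expectations on `C_b(G)` -/

/-- A conditional expectation on the commutative C*-algebra `C_b(X)`: a norm-one idempotent onto a
C*-subalgebra which is positive, is a bimodule map over this subalgebra and satisfies the Schwarz
inequality. The range of the idempotent is `{b | P b = b}`; it is automatically a closed subspace, and
it is closed under the involution by positivity, so it is a C*-subalgebra as soon as it is closed under
products. -/
structure IsConditionalExpectation {X : Type*} [TopologicalSpace X]
    (P : (X →ᵇ ℂ) →L[ℂ] (X →ᵇ ℂ)) : Prop where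
  idem : ∀ f, P (P f) = P f
  norm_eq_one : ‖P‖ = 1
  range_mul : ∀ b₁ b₂, P b₁ = b₁ → P b₂ = b₂ → P (b₁ * b₂) = b₁ * b₂
  nonneg : ∀ f x, 0 ≤ P (star f * f) x
  bimodule : ∀ b₁ f b₂, P b₁ = b₁ → P b₂ = b₂ → P (b₁ * f * b₂) = b₁ * P f * b₂
  schwarz : ∀ f x, P (star f) x * P f x ≤ P (star f * f) x

/-- The function `x ↦ F (x, y)`. -/
def sliceLeft {X Y : Type*} [TopologicalSpace X] [TopologicalSpace Y] (F : X × Y →ᵇ ℂ) (y : Y) :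
    X →ᵇ ℂ := F.compContinuous ⟨fun x => (x, y), by fun_prop⟩

/-- The function `y ↦ F (x, y)`. -/
def sliceRight {X Y : Type*} [TopologicalSpace X] [TopologicalSpace Y] (F : X × Y →ᵇ ℂ) (x : X) :
    Y →ᵇ ℂ := F.compContinuous ⟨fun y => (x, y), by fun_prop⟩

/-- The group comultiplication `(Δ f)(p, q) = f (p q)`. -/
def comul {G : Type*} [TopologicalSpace G] [Group G] [IsTopologicalGroup G] (f : G →ᵇ ℂ) :
    G × G →ᵇ ℂ := f.compContinuous ⟨fun p => p.1 * p.2, by fun_prop⟩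

lemma hasCompactSupport_slice {G : Type*} [TopologicalSpace G] [Group G] [IsTopologicalGroup G]
    {h : G →ᵇ ℂ} (hh : HasCompactSupport h) (p : G) :
    HasCompactSupport (sliceRight (comul h) p) :=
  hh.comp_homeomorph (Homeomorph.mulLeft p)

/-- `f̌ (p) = f (p⁻¹)`. -/
def check {G : Type*} [TopologicalSpace G] [Group G] [IsTopologicalGroup G] (f : G →ᵇ ℂ) :
    G →ᵇ ℂ := f.compContinuous ⟨fun p => p⁻¹, by fun_prop⟩

/-- A conditional expectation on `C_b(G)` which maps the cone `𝒦₊(G)` of nonnegative continuous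
functions with compact support to itself, and such that `f p > 0` implies `(P f) p > 0` for
`f ∈ 𝒦₊(G)`. -/
structure ProperExpectation (G : Type*) [TopologicalSpace G] where
  /-- the expectation -/
  P : (G →ᵇ ℂ) →L[ℂ] (G →ᵇ ℂ)
  isCondExp : IsConditionalExpectation P
  map_cone : ∀ f : G →ᵇ ℂ, HasCompactSupport f → (∀ x, 0 ≤ f x) →
    HasCompactSupport (P f) ∧ ∀ x, 0 ≤ P f x
  map_pos : ∀ f : G →ᵇ ℂ, HasCompactSupport f → (∀ x, 0 ≤ f x) → ∀ p, 0 < f p → 0 < P f p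

/-- On a compact set, the slices of a continuous function depend continuously on the parameter. -/
lemma slice_uniform {X Y : Type*} [TopologicalSpace X] [TopologicalSpace Y] {F : X × Y → ℂ}
    (hF : Continuous F) {K : Set X} (hK : IsCompact K) (y₀ : Y) {ε : ℝ} (hε : 0 < ε) :
    ∀ᶠ y in 𝓝 y₀, ∀ x ∈ K, ‖F (x, y) - F (x, y₀)‖ < ε := by
  have h : ∀ x ∈ K, ∀ᶠ z : X × Y in 𝓝 (x, y₀), ‖F z - F (z.1, y₀)‖ < ε := by
    intro x _
    have hc : Continuous fun z : X × Y => ‖F z - F (z.1, y₀)‖ := by fun_prop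
    have := hc.tendsto (x, y₀)
    simp only [sub_self, norm_zero] at this
    exact this.eventually (gt_mem_nhds hε)
  have h2 : ∀ᶠ y in 𝓝 y₀, ∀ x ∈ K, ‖F (x, y) - F ((x, y).1, y₀)‖ < ε :=
    hK.eventually_forall_of_forall_eventually (fun x hx => by
      have := h x hx
      have hs : Filter.Tendsto (fun z : Y × X => (z.2, z.1)) (𝓝 (y₀, x)) (𝓝 (x, y₀)) := by
        have : Continuous (fun z : Y × X => (z.2, z.1)) := by fun_prop
        exact this.tendsto (y₀, x)
      exact hs.eventually this)
  simpa using h2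

lemma exists_bump {X : Type*} [TopologicalSpace X] [LocallyCompactSpace X] [T2Space X] {K : Set X}
    (hK : IsCompact K) : ∃ k : X →ᵇ ℂ, HasCompactSupport k ∧ (∀ x, 0 ≤ k x) ∧ ∀ x ∈ K, k x = 1 := by
  obtain ⟨f, h1, -, h3, h4⟩ := exists_continuous_one_zero_of_isCompact hK isClosed_empty
    (Set.disjoint_empty K)
  refine ⟨BoundedContinuousFunction.ofNormedAddCommGroup (fun x => (f x : ℂ)) (by fun_prop) 1 ?_,
    ?_, ?_, ?_⟩
  · intro x
    rw [Complex.norm_real, Real.norm_of_nonneg (h4 x).1]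
    exact (h4 x).2
  · exact h3.comp_left (g := fun r : ℝ => (r : ℂ)) (by simp)
  · intro x
    simpa using (h4 x).1
  · intro x hx
    simpa using h1 hx

lemma continuous_eval_bcf {X Z : Type*} [TopologicalSpace X] [TopologicalSpace Z]
    {H : Z → (X →ᵇ ℂ)} (hH : Continuous H) : Continuous fun z : X × Z => H z.2 z.1 := by
  rw [continuous_iff_continuousAt]
  rintro ⟨x₀, z₀⟩
  have h1 : Filter.Tendsto (fun z : X × Z => ‖H z.2 - H z₀‖) (𝓝 (x₀, z₀)) (𝓝 0) := by
    have : Continuous fun z : X × Z => ‖H z.2 - H z₀‖ := by fun_prop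
    simpa using this.tendsto (x₀, z₀)
  have h2 : Filter.Tendsto (fun z : X × Z => H z.2 z.1 - H z₀ z.1) (𝓝 (x₀, z₀)) (𝓝 0) := by
    refine squeeze_zero_norm (fun z => ?_) h1
    exact (H z.2 - H z₀).norm_coe_le_norm z.1
  have h3 : Filter.Tendsto (fun z : X × Z => H z₀ z.1) (𝓝 (x₀, z₀)) (𝓝 (H z₀ x₀)) := by
    have : Continuous fun z : X × Z => H z₀ z.1 := by fun_prop
    exact this.tendsto (x₀, z₀)
  simpa [ContinuousAt] using h2.add h3

namespace ProperExpectation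

variable {G : Type*} [TopologicalSpace G]

lemma norm_apply_le (E : ProperExpectation G) (f : G →ᵇ ℂ) : ‖E.P f‖ ≤ ‖f‖ := by
  simpa [E.isCondExp.norm_eq_one] using E.P.le_opNorm f

lemma map_star (E : ProperExpectation G) (f : G →ᵇ ℂ) : E.P (star f) = star (E.P f) := by
  have key : ∀ c : ℂ, star (E.P (star (f + c • 1) * (f + c • 1))) =
      E.P (star (f + c • 1) * (f + c • 1)) := by
    intro c
    ext x
    exact Complex.conj_eq_iff_im.2 (Complex.nonneg_iff.1 (E.isCondExp.nonneg (f + c • 1) x)).2.symm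
  have e1 : ∀ c : ℂ, star (f + c • 1) * (f + c • 1) =
      star f * f + c • star f + (star c) • f + (star c * c) • 1 := by
    intro c
    ext x
    simp
    ring
  have k0 := key 0
  have k1 := key 1
  have k2 := key Complex.I
  rw [e1] at k0 k1 k2
  ext x
  have j0 := DFunLike.congr_fun k0 x
  have j1 := DFunLike.congr_fun k1 x
  have j2 := DFunLike.congr_fun k2 x
  simp [map_add, map_smul] at j0 j1 j2 ⊢
  have j3 : (starRingEnd ℂ) (E.P 1 x) = E.P 1 x := by
    have := E.isCondExp.nonneg 1 x
    rw [star_one, one_mul] at this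
    exact Complex.conj_eq_iff_im.2 (Complex.nonneg_iff.1 this).2.symm
  linear_combination (-1 / 2 : ℂ) * (j1 - j0 - j3) + (Complex.I / 2) * (j2 - j0 - j3) +
    ((starRingEnd ℂ (E.P (star f) x) - starRingEnd ℂ (E.P f x) - E.P f x + E.P (star f) x) / 2) *
      Complex.I_sq

/-- `P (|f|²)` dominates `|P f|²`. -/
lemma norm_sq_le (E : ProperExpectation G) (f : G →ᵇ ℂ) (x : G) :
    ((‖E.P f x‖ ^ 2 : ℝ) : ℂ) ≤ E.P (star f * f) x := by
  have := E.isCondExp.schwarz f x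
  rw [E.map_star] at this
  refine le_trans (le_of_eq ?_) this
  simp [Complex.conj_mul']

lemma mul_apply (E : ProperExpectation G) (f k : G →ᵇ ℂ) (x : G) :
    E.P f x * (E.P k x * E.P k x) = E.P (E.P k * f * E.P k) x := by
  rw [E.isCondExp.bimodule _ _ _ (E.isCondExp.idem k) (E.isCondExp.idem k)]
  simp only [BoundedContinuousFunction.coe_mul, Pi.mul_apply]
  ring

/-- On a compact set, `P f` depends only on the values of `f` on some compact set. -/
lemma exists_compact_control [LocallyCompactSpace G] [T2Space G] (E : ProperExpectation G)
    {K : Set G} (hK : IsCompact K) : ∃ L : Set G, IsCompact L ∧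
      ∀ f : G →ᵇ ℂ, (∀ x ∈ L, f x = 0) → ∀ x ∈ K, E.P f x = 0 := by
  obtain ⟨k, hk, hk0, hk1⟩ := exists_bump hK
  refine ⟨tsupport (E.P k), (E.map_cone k hk hk0).1, fun f hf x hx => ?_⟩
  have hpos : E.P k x ≠ 0 := (E.map_pos k hk hk0 x (by rw [hk1 x hx]; exact one_pos)).ne'
  have h0 : E.P k * f * E.P k = 0 := by
    ext y
    by_cases hy : y ∈ tsupport (E.P k)
    · simp [hf y hy]
    · simp [image_eq_zero_of_notMem_tsupport hy]
  have := E.mul_apply f k x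
  rw [h0, map_zero] at this
  simpa [hpos] using this

/-- `P` preserves compactness of the support. -/
lemma map_hasCompactSupport [LocallyCompactSpace G] [T2Space G] (E : ProperExpectation G)
    {f : G →ᵇ ℂ} (hf : HasCompactSupport f) : HasCompactSupport (E.P f) := by
  have hs : HasCompactSupport (star f * f : G →ᵇ ℂ) := by
    rw [BoundedContinuousFunction.coe_mul]
    exact hf.mul_left
  have h0 : ∀ x, 0 ≤ (star f * f : G →ᵇ ℂ) x := by
    intro x
    simpa using star_mul_self_nonneg (f x)
  refine (E.map_cone _ hs h0).1.mono' ?_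
  intro x hx
  refine subset_tsupport _ ?_
  rw [Function.mem_support] at hx ⊢
  intro h
  have := E.norm_sq_le f x
  rw [h] at this
  have h2 : ‖E.P f x‖ ^ 2 ≤ 0 := by exact_mod_cast this
  exact hx (by simpa using h2)

/-- `u f u` depends continuously on the parameter, `f` being a slice and `u` having compact
support. -/
lemma continuous_mul_slice {Y : Type*} [TopologicalSpace Y] (F : G × Y →ᵇ ℂ) {u : G →ᵇ ℂ}
    (hu : HasCompactSupport u) : Continuous fun y => u * sliceLeft F y * u := by
  rw [continuous_iff_continuousAt]
  intro y₀
  rw [ContinuousAt, Metric.tendsto_nhds]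
  intro ε hε
  have hd : 0 < ε / (2 * (‖u‖ * ‖u‖ + 1)) := by positivity
  filter_upwards [slice_uniform F.continuous hu.isCompact y₀ hd] with y hy
  rw [dist_eq_norm]
  refine lt_of_le_of_lt (b := ε / 2) ?_ (by linarith)
  rw [BoundedContinuousFunction.norm_le (by positivity)]
  intro x
  by_cases hx : x ∈ tsupport u
  · have h1 := (hy x hx).le
    have hux := u.norm_coe_le_norm x
    calc ‖(u * sliceLeft F y * u - u * sliceLeft F y₀ * u) x‖
        = ‖u x‖ * ‖u x‖ * ‖F (x, y) - F (x, y₀)‖ := by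
          rw [← norm_mul, ← norm_mul]
          congr 1
          simp [sliceLeft]
          ring
      _ ≤ (‖u‖ * ‖u‖ + 1) * (ε / (2 * (‖u‖ * ‖u‖ + 1))) := by
          gcongr
          nlinarith [norm_nonneg (u x), norm_nonneg u]
      _ = ε / 2 := by field_simp
  · simp [image_eq_zero_of_notMem_tsupport hx]
    positivity

lemma continuous_prodId [LocallyCompactSpace G] [T2Space G] {Y : Type*} [TopologicalSpace Y]
    (E : ProperExpectation G) (F : G × Y →ᵇ ℂ) :
    Continuous fun z : G × Y => E.P (sliceLeft F z.2) z.1 := by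
  rw [continuous_iff_continuousAt]
  rintro ⟨x₀, y₀⟩
  obtain ⟨k, hk, hk0, hk1⟩ := exists_bump (isCompact_singleton (x := x₀))
  have hpos : E.P k x₀ ≠ 0 := (E.map_pos k hk hk0 x₀ (by rw [hk1 x₀ rfl]; exact one_pos)).ne'
  have h1 : Continuous fun z : G × Y => E.P (E.P k * sliceLeft F z.2 * E.P k) z.1 :=
    continuous_eval_bcf (E.P.continuous.comp (continuous_mul_slice F (E.map_cone k hk hk0).1))
  have h2 : Continuous fun z : G × Y => E.P k z.1 * E.P k z.1 := by fun_prop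
  have h3 : ContinuousAt (fun z : G × Y => E.P (E.P k * sliceLeft F z.2 * E.P k) z.1 /
      (E.P k z.1 * E.P k z.1)) (x₀, y₀) :=
    h1.continuousAt.div h2.continuousAt (mul_ne_zero hpos hpos)
  refine h3.congr ?_
  have h4 : ∀ᶠ z : G × Y in 𝓝 (x₀, y₀), E.P k z.1 * E.P k z.1 ≠ 0 :=
    h2.continuousAt.eventually_ne (mul_ne_zero hpos hpos)
  filter_upwards [h4] with z hz
  rw [div_eq_iff hz, E.mul_apply]

/-- The map `P × id` on `C_b(G × Y)`. -/
def prodId [LocallyCompactSpace G] [T2Space G] {Y : Type*} [TopologicalSpace Y]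
    (E : ProperExpectation G) (F : G × Y →ᵇ ℂ) : G × Y →ᵇ ℂ :=
  BoundedContinuousFunction.ofNormedAddCommGroup (fun z : G × Y => E.P (sliceLeft F z.2) z.1)
    (E.continuous_prodId F) ‖F‖ (fun _ => ((E.P _).norm_coe_le_norm _).trans
      ((E.norm_apply_le _).trans
        ((BoundedContinuousFunction.norm_le (norm_nonneg F)).2 fun _ => F.norm_coe_le_norm _)))

/-- The map `id × P` on `C_b(Y × G)`. -/
def idProd [LocallyCompactSpace G] [T2Space G] {Y : Type*} [TopologicalSpace Y]
    (E : ProperExpectation G) (F : Y × G →ᵇ ℂ) : Y × G →ᵇ ℂ :=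
  (E.prodId (F.compContinuous ⟨Prod.swap, by fun_prop⟩)).compContinuous ⟨Prod.swap, by fun_prop⟩

@[simp] lemma prodId_apply [LocallyCompactSpace G] [T2Space G] {Y : Type*} [TopologicalSpace Y]
    (E : ProperExpectation G) (F : G × Y →ᵇ ℂ) (x : G) (y : Y) :
    E.prodId F (x, y) = E.P (sliceLeft F y) x := rfl

@[simp] lemma idProd_apply [LocallyCompactSpace G] [T2Space G] {Y : Type*} [TopologicalSpace Y]
    (E : ProperExpectation G) (F : Y × G →ᵇ ℂ) (y : Y) (x : G) :
    E.idProd F (y, x) = E.P (sliceRight F y) x := rfl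

end ProperExpectation


/-! ### The spectrum of `P(C₀(G))` and the comultiplication on it -/

/-- A conditional expectation on `C_b(G)` from which a hypergroup is constructed: it is compatible
with the comultiplication and with the inversion of the group. -/
structure HypergroupExpectation (G : Type*) [TopologicalSpace G] [Group G] [IsTopologicalGroup G]
    [LocallyCompactSpace G] [T2Space G] extends ProperExpectation G where
  prodId_comul : ∀ f : G →ᵇ ℂ, toProperExpectation.prodId (comul (P f)) =
    toProperExpectation.prodId (toProperExpectation.idProd (comul f))
  idProd_comul : ∀ f : G →ᵇ ℂ, toProperExpectation.idProd (comul (P f)) =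
    toProperExpectation.prodId (toProperExpectation.idProd (comul f))
  map_check : ∀ f : G →ᵇ ℂ, P (check f) = check (P f)

namespace HypergroupExpectation

variable {G : Type*} [TopologicalSpace G] [Group G] [IsTopologicalGroup G]
  [LocallyCompactSpace G] [T2Space G]

/-- The commutative C*-algebra `B = P(C₀(G))`. -/
def B (E : HypergroupExpectation G) : NonUnitalStarSubalgebra ℂ C₀(G, ℂ) where
  carrier := {b | ∃ f : C₀(G, ℂ), E.P f.toBCF = b.toBCF}
  add_mem' := by
    rintro a b ⟨f, hf⟩ ⟨g, hg⟩
    refine ⟨f + g, ?_⟩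
    have h : ∀ a b : C₀(G, ℂ), (a + b).toBCF = a.toBCF + b.toBCF := fun _ _ => rfl
    rw [h, h, map_add, hf, hg]
  zero_mem' := ⟨0, map_zero E.P⟩
  mul_mem' := by
    rintro a b ⟨f, hf⟩ ⟨g, hg⟩
    refine ⟨a * b, ?_⟩
    have h : ∀ a b : C₀(G, ℂ), (a * b).toBCF = a.toBCF * b.toBCF := fun _ _ => rfl
    rw [h]
    exact E.isCondExp.range_mul _ _ (by rw [← hf, E.isCondExp.idem])
      (by rw [← hg, E.isCondExp.idem])
  smul_mem' := by
    rintro c a ⟨f, hf⟩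
    refine ⟨c • f, ?_⟩
    have h : ∀ a : C₀(G, ℂ), (c • a).toBCF = c • a.toBCF := fun _ => rfl
    rw [h, h, map_smul, hf]
  star_mem' := by
    rintro a ⟨f, hf⟩
    refine ⟨star f, ?_⟩
    have h : ∀ a : C₀(G, ℂ), (star a).toBCF = star a.toBCF := fun _ => rfl
    rw [h, h, E.map_star, hf]

/-- The underlying space of the hypergroup: the Gelfand spectrum of `B`. -/
def Q (E : HypergroupExpectation G) : Type _ := WeakDual.characterSpace ℂ E.B

instance (E : HypergroupExpectation G) : TopologicalSpace E.Q :=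
  inferInstanceAs (TopologicalSpace (WeakDual.characterSpace ℂ E.B))

instance (E : HypergroupExpectation G) : T2Space E.Q :=
  inferInstanceAs (T2Space (WeakDual.characterSpace ℂ E.B))

instance (E : HypergroupExpectation G) : FunLike E.Q E.B ℂ :=
  inferInstanceAs (FunLike (WeakDual.characterSpace ℂ E.B) E.B ℂ)

instance (E : HypergroupExpectation G) : MeasurableSpace E.Q := borel E.Q

instance (E : HypergroupExpectation G) : BorelSpace E.Q := ⟨rfl⟩

lemma continuous_apply (E : HypergroupExpectation G) (b : E.B) : Continuous fun s : E.Q => s b :=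
  (WeakDual.eval_continuous b).comp continuous_subtype_val

lemma apply_add (E : HypergroupExpectation G) (s : E.Q) (a b : E.B) : s (a + b) = s a + s b :=
  s.1.map_add a b

lemma apply_smul (E : HypergroupExpectation G) (s : E.Q) (c : ℂ) (a : E.B) :
    s (c • a) = c * s a := s.1.map_smul c a

lemma apply_mul (E : HypergroupExpectation G) (s : E.Q) (a b : E.B) : s (a * b) = s a * s b :=
  s.2.2 a b

lemma exists_bound (E : HypergroupExpectation G) (s : E.Q) : ∃ C, 0 < C ∧ ∀ a : E.B,
    ‖s a‖ ≤ C * ‖(a : C₀(G, ℂ))‖ :=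
  (ContinuousLinearMap.isBoundedLinearMap (𝕜 := ℂ) (E := E.B) (F := ℂ)
    (WeakDual.toStrongDual s.1)).bound

/-- For a function `k ∈ 𝒦(G)`, the element `P k` of `B`. -/
def mkB (E : HypergroupExpectation G) (k : G →ᵇ ℂ) (hk : HasCompactSupport k) : E.B :=
  ⟨⟨⟨E.P k, (E.P k).continuous⟩, (E.map_hasCompactSupport hk).is_zero_at_infty⟩,
    ⟨⟨⟨k, k.continuous⟩, hk.is_zero_at_infty⟩, rfl⟩⟩

lemma exists_pos (E : HypergroupExpectation G) {K : Set G} (hK : IsCompact K) :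
    ∃ b : E.B, HasCompactSupport b.1 ∧ (∀ p, 0 ≤ b.1 p) ∧ ∀ p ∈ K, 0 < b.1 p := by
  obtain ⟨k, hk, hk0, hk1⟩ := exists_bump hK
  exact ⟨E.mkB k hk, (E.map_cone k hk hk0).1, (E.map_cone k hk hk0).2,
    fun p hp => E.map_pos k hk hk0 p (by rw [hk1 p hp]; exact one_pos)⟩

/-- The map `φ : G → Q` sending `p` to the evaluation at `p`. -/
def φ (E : HypergroupExpectation G) (p : G) : E.Q :=
  ⟨{  toFun := fun b => b.1 p
      map_add' := fun _ _ => rfl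
      map_smul' := fun _ _ => rfl
      cont := by
        have h : Continuous fun b : E.B => (b : C₀(G, ℂ)).toBCF p :=
          (BoundedContinuousFunction.lipschitz_eval_const p).continuous.comp
            ((ZeroAtInftyContinuousMap.isometry_toBCF).continuous.comp continuous_subtype_val)
        exact h }, by
    constructor
    · intro h
      obtain ⟨b, -, -, hb⟩ := E.exists_pos (isCompact_singleton (x := p))
      exact (hb p rfl).ne' (DFunLike.congr_fun h b)
    · intro a b
      rfl⟩

@[simp] lemma φ_apply (E : HypergroupExpectation G) (p : G) (b : E.B) : E.φ p b = b.1 p := rfl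

lemma continuous_φ (E : HypergroupExpectation G) : Continuous E.φ := by
  refine Continuous.subtype_mk (WeakDual.continuous_of_continuous_eval fun b => ?_) _
  exact b.1.continuous

lemma isCompact_ge (E : HypergroupExpectation G) (b : E.B) {ε : ℝ} (hε : 0 < ε) :
    IsCompact {p | ε ≤ ‖b.1 p‖} := by
  have h1 : {p | ε ≤ ‖b.1 p‖}ᶜ ∈ Filter.cocompact G := by
    have h := (zero_at_infty b.1).norm
    rw [norm_zero] at h
    filter_upwards [h.eventually (gt_mem_nhds hε)] with p hp
    simpa using hp
  obtain ⟨K, hK, hKs⟩ := Filter.mem_cocompact.1 h1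
  exact hK.of_isClosed_subset (isClosed_le continuous_const b.1.continuous.norm)
    (Set.compl_subset_compl.1 hKs)

lemma exists_ne_zero (E : HypergroupExpectation G) (s : E.Q) : ∃ b : E.B, s b ≠ 0 := by
  by_contra! h
  exact s.2.1 (ContinuousLinearMap.ext h)

/-- Every character of `B` is the evaluation at a point of `G`. -/
lemma surjective_φ (E : HypergroupExpectation G) : Function.Surjective E.φ := by
  intro s
  by_contra hs
  obtain ⟨C, hC, hbd⟩ := E.exists_bound s
  obtain ⟨g, hg⟩ := E.exists_ne_zero s
  -- every point is moved away by an element of the kernel of `s`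
  have hker : ∀ p : G, ∃ b : E.B, s b = 0 ∧ b.1 p ≠ 0 := by
    intro p
    by_contra! h
    apply hs
    refine ⟨p, ?_⟩
    have hgp : ∀ b : E.B, s b * g.1 p = s g * b.1 p := by
      intro b
      have := h ((s g) • b + (-s b) • g) ?_
      · have h2 : (s g) * b.1 p + (-s b) * g.1 p = 0 := this
        linear_combination -h2
      · rw [E.apply_add, E.apply_smul, E.apply_smul]
        ring
    have hg0 : g.1 p ≠ 0 := by
      intro h0
      obtain ⟨b, -, -, hb⟩ := E.exists_pos (isCompact_singleton (x := p))
      have h1 := hgp b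
      rw [h0, mul_zero] at h1
      exact mul_ne_zero hg (hb p rfl).ne' h1.symm
    have hm := hgp (g * g)
    rw [E.apply_mul] at hm
    have h3 : s g * s g * g.1 p = s g * (g.1 p * g.1 p) := hm
    have h4 : s g = g.1 p := by
      have : s g * g.1 p ≠ 0 := mul_ne_zero hg hg0
      apply mul_left_cancel₀ this
      linear_combination h3
    refine Subtype.ext (ContinuousLinearMap.ext fun b => ?_)
    have h5 := hgp b
    rw [h4, mul_comm] at h5
    exact (mul_left_cancel₀ hg0 h5).symm
  set ε : ℝ := ‖s g‖ / (2 * C) with hε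
  have hε0 : 0 < ε := by have := norm_pos_iff.2 hg; positivity
  have hK := E.isCompact_ge g hε0
  set K : Set G := {p | ε ≤ ‖g.1 p‖} with hKdef
  -- a nonnegative element of the kernel of `s` which is positive on `K`
  obtain ⟨h, hsh, hh0, hhK⟩ : ∃ h : E.B, s h = 0 ∧ (∀ p, 0 ≤ h.1 p) ∧ ∀ p ∈ K, 0 < h.1 p := by
    refine hK.induction_on (p := fun S => ∃ h : E.B, s h = 0 ∧ (∀ p, 0 ≤ h.1 p) ∧
      ∀ p ∈ S, 0 < h.1 p) ⟨0, s.1.map_zero, fun _ => le_rfl, by simp⟩ ?_ ?_ ?_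
    · rintro S T hST ⟨h, h1, h2, h3⟩
      exact ⟨h, h1, h2, fun p hp => h3 p (hST hp)⟩
    · rintro S T ⟨h, h1, h2, h3⟩ ⟨h', h1', h2', h3'⟩
      refine ⟨h + h', by rw [E.apply_add, h1, h1', add_zero], fun p => add_nonneg (h2 p) (h2' p), ?_⟩
      rintro p (hp | hp)
      · exact add_pos_of_pos_of_nonneg (h3 p hp) (h2' p)
      · exact add_pos_of_nonneg_of_pos (h2 p) (h3' p hp)
    · intro p _
      obtain ⟨b, hb, hbp⟩ := hker p
      have hval : ∀ q, (star b * b).1 q = ((‖b.1 q‖ ^ 2 : ℝ) : ℂ) := by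
        intro q
        have : (star b * b).1 q = star (b.1 q) * b.1 q := rfl
        rw [this]
        simp [Complex.conj_mul']
      refine ⟨{q | b.1 q ≠ 0}, mem_nhdsWithin_of_mem_nhds
        ((isOpen_ne_fun b.1.continuous continuous_const).mem_nhds hbp), star b * b, ?_, ?_, ?_⟩
      · rw [E.apply_mul, hb, mul_zero]
      · intro q
        rw [hval]
        exact_mod_cast sq_nonneg ‖b.1 q‖
      · intro q hq
        rw [hval]
        have : 0 < ‖b.1 q‖ := norm_pos_iff.2 hq
        exact_mod_cast pow_pos this 2
  have hre : ∀ p, h.1 p = ((h.1 p).re : ℂ) := fun p =>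
    Complex.ext rfl (Complex.nonneg_iff.1 (hh0 p)).2.symm
  have hre0 : ∀ p, 0 ≤ (h.1 p).re := fun p => (Complex.nonneg_iff.1 (hh0 p)).1
  have hreK : ∀ p ∈ K, 0 < (h.1 p).re := fun p hp => (Complex.pos_iff.1 (hhK p hp)).1
  obtain ⟨c, hc0, hcK⟩ : ∃ c : ℝ, 0 < c ∧ ∀ p ∈ K, c ≤ (h.1 p).re := by
    rcases K.eq_empty_or_nonempty with hemp | hne
    · exact ⟨1, one_pos, by simp [hemp]⟩
    · obtain ⟨p, hp, hmin⟩ := hK.exists_isMinOn hne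
        (Complex.continuous_re.comp h.1.continuous).continuousOn
      exact ⟨(h.1 p).re, hreK p hp, fun q hq => hmin hq⟩
  set M : ℝ := ‖(h : C₀(G, ℂ))‖ + c + 1 with hM
  have hM0 : 0 < M := by positivity
  have hhM : ∀ p, (h.1 p).re ≤ M := by
    intro p
    have h1 : ‖h.1 p‖ ≤ ‖(h : C₀(G, ℂ))‖ := h.1.toBCF.norm_coe_le_norm p
    have h2 := Complex.re_le_norm (h.1 p)
    linarith
  let x : ℕ → E.B := fun n => Nat.rec (motive := fun _ => E.B) g
    (fun _ y => y + (-(M : ℂ)⁻¹) • (y * h)) n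
  have hx : ∀ n, x (n + 1) = x n + (-(M : ℂ)⁻¹) • (x n * h) := fun n => rfl
  have hsx : ∀ n, s (x n) = s g := by
    intro n
    induction n with
    | zero => rfl
    | succ n ih => rw [hx, E.apply_add, E.apply_smul, E.apply_mul, hsh, ih]; simp
  have hxv : ∀ n p, (x n).1 p = g.1 p * ((1 - (h.1 p).re / M : ℝ) : ℂ) ^ n := by
    intro n p
    induction n with
    | zero => simp [x]
    | succ n ih =>
      have : (x (n + 1)).1 p = (x n).1 p + (-(M : ℂ)⁻¹) * ((x n).1 p * h.1 p) := rfl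
      rw [this, ih, hre p, pow_succ]
      push_cast
      simp only [Complex.ofReal_re]
      ring
  have hcM : c / M < 1 := by
    rw [div_lt_one hM0]
    have := norm_nonneg (h : C₀(G, ℂ))
    linarith
  obtain ⟨n, hn⟩ := exists_pow_lt_of_lt_one (show 0 < ε / (‖(g : C₀(G, ℂ))‖ + 1) by positivity)
    (show 1 - c / M < 1 by have : 0 < c / M := by positivity
                           linarith)
  have hxn : ‖((x n : E.B) : C₀(G, ℂ))‖ ≤ ε := by
    refine (BoundedContinuousFunction.norm_le (f := ZeroAtInftyContinuousMap.toBCF (x n).1) hε0.le).2 fun p => ?_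
    have h1 : ‖(x n).1 p‖ = ‖g.1 p‖ * (1 - (h.1 p).re / M) ^ n := by
      have h2 : 0 ≤ 1 - (h.1 p).re / M := by
        rw [sub_nonneg, div_le_one hM0]
        exact hhM p
      rw [hxv, norm_mul, norm_pow, Complex.norm_real, Real.norm_of_nonneg h2]
    change ‖(x n).1 p‖ ≤ ε
    rw [h1]
    have hle : 1 - (h.1 p).re / M ≤ 1 := by
      have : 0 ≤ (h.1 p).re / M := div_nonneg (hre0 p) hM0.le
      linarith
    have hge : 0 ≤ 1 - (h.1 p).re / M := by
      rw [sub_nonneg, div_le_one hM0]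
      exact hhM p
    by_cases hp : p ∈ K
    · have h3 : 1 - (h.1 p).re / M ≤ 1 - c / M := by
        have := hcK p hp
        gcongr
      have h4 : ‖g.1 p‖ ≤ ‖(g : C₀(G, ℂ))‖ := g.1.toBCF.norm_coe_le_norm p
      calc ‖g.1 p‖ * (1 - (h.1 p).re / M) ^ n
          ≤ (‖(g : C₀(G, ℂ))‖ + 1) * (ε / (‖(g : C₀(G, ℂ))‖ + 1)) := by
            gcongr
            · linarith
            · exact (pow_le_pow_left₀ hge h3 n).trans hn.le
        _ = ε := by field_simp
    · have h5 : ‖g.1 p‖ < ε := not_le.1 hp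
      calc ‖g.1 p‖ * (1 - (h.1 p).re / M) ^ n ≤ ‖g.1 p‖ * 1 := by
            gcongr
            exact pow_le_one₀ hge hle
        _ ≤ ε := by linarith
  have h6 := hbd (x n)
  rw [hsx] at h6
  have h7 : ‖s g‖ ≤ C * ε := h6.trans (by gcongr)
  have h8 : C * ε = ‖s g‖ / 2 := by rw [hε]; field_simp
  have := norm_pos_iff.2 hg
  linarith

lemma isProperMap_φ (E : HypergroupExpectation G) : IsProperMap E.φ := by
  rw [isProperMap_iff_ultrafilter]
  refine ⟨E.continuous_φ, fun 𝒰 s h => ?_⟩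
  obtain ⟨b, hb⟩ := E.exists_ne_zero s
  have h1 : Filter.Tendsto (fun p => ‖b.1 p‖) 𝒰 (𝓝 ‖s b‖) :=
    (((E.continuous_apply b).norm.tendsto s).comp h)
  have h2 : ∀ᶠ p in (𝒰 : Filter G), p ∈ {p | ‖s b‖ / 2 ≤ ‖b.1 p‖} :=
    (h1.eventually (lt_mem_nhds (half_lt_self (norm_pos_iff.2 hb)))).mono fun p hp => le_of_lt hp
  obtain ⟨p, -, hp⟩ := (E.isCompact_ge b (half_pos (norm_pos_iff.2 hb))).ultrafilter_le_nhds 𝒰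
    (Filter.le_principal_iff.2 h2)
  refine ⟨p, ?_, hp⟩
  exact tendsto_nhds_unique ((E.continuous_φ.tendsto p).comp hp) h

lemma isQuotientMap_prodMap_φ (E : HypergroupExpectation G) :
    Topology.IsQuotientMap (Prod.map E.φ E.φ) := by
  have h := E.isProperMap_φ.prodMap E.isProperMap_φ
  exact h.isClosedMap.isQuotientMap h.continuous (E.surjective_φ.prodMap E.surjective_φ)

/-- Functions in the range of `P` are constant on the fibres of `φ`. -/
lemma apply_eq_of_φ_eq (E : HypergroupExpectation G) (f : G →ᵇ ℂ) {p q : G}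
    (h : E.φ p = E.φ q) : E.P f p = E.P f q := by
  obtain ⟨k, hk, hk0, hk1⟩ := exists_bump (isCompact_singleton (x := p))
  have hpos : E.P k p ≠ 0 := (E.map_pos k hk hk0 p (by rw [hk1 p rfl]; exact one_pos)).ne'
  have hb : ∀ b : E.B, b.1 p = b.1 q := fun b => DFunLike.congr_fun h b
  have h1 : E.P k p = E.P k q := hb (E.mkB k hk)
  have hs : HasCompactSupport (E.P k * f * E.P k : G →ᵇ ℂ) := by
    rw [BoundedContinuousFunction.coe_mul]
    exact (E.map_cone k hk hk0).1.mul_left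
  have h2 : E.P (E.P k * f * E.P k) p = E.P (E.P k * f * E.P k) q := hb (E.mkB _ hs)
  rw [← E.mul_apply, ← E.mul_apply, ← h1] at h2
  exact mul_right_cancel₀ (mul_ne_zero hpos hpos) h2

/-- `(P × P) Δ f`, at points of `G × G`, depends only on the images of these points in `Q × Q`. -/
lemma prod_comul_eq (E : HypergroupExpectation G) (f : G →ᵇ ℂ) {p q p' q' : G}
    (hp : E.φ p = E.φ p') (hq : E.φ q = E.φ q') :
    E.prodId (E.idProd (comul f)) (p, q) = E.prodId (E.idProd (comul f)) (p', q') := by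
  have h1 : E.prodId (E.idProd (comul f)) (p, q) = E.prodId (E.idProd (comul f)) (p', q) :=
    E.apply_eq_of_φ_eq _ hp
  rw [h1, ← E.idProd_comul]
  exact E.apply_eq_of_φ_eq _ hq

/-- A function on `Q`, viewed as a function on `G`. -/
def lift (E : HypergroupExpectation G) (f : E.Q →ᵇ ℂ) : G →ᵇ ℂ :=
  f.compContinuous ⟨E.φ, E.continuous_φ⟩

/-- A section of the surjection `φ`. -/
def sec (E : HypergroupExpectation G) : E.Q → G := Function.surjInv E.surjective_φ

lemma φ_sec (E : HypergroupExpectation G) (s : E.Q) : E.φ (E.sec s) = s :=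
  Function.surjInv_eq E.surjective_φ s

/-- The comultiplication `(P × P) ∘ Δ : C_b(Q) → C_b(Q × Q)`, where functions on `Q` and `Q × Q` are
identified through `φ` with functions on `G` and `G × G` (see `comulQ_φ`). -/
def comulQ (E : HypergroupExpectation G) (f : E.Q →ᵇ ℂ) : E.Q × E.Q →ᵇ ℂ :=
  BoundedContinuousFunction.ofNormedAddCommGroup
    (fun z => E.prodId (E.idProd (comul (E.lift f))) (E.sec z.1, E.sec z.2))
    (by
      rw [E.isQuotientMap_prodMap_φ.continuous_iff]
      refine (E.prodId (E.idProd (comul (E.lift f)))).continuous.congr fun z => ?_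
      exact E.prod_comul_eq _ (E.φ_sec _).symm (E.φ_sec _).symm)
    ‖f‖ (fun z => by
      have h0 : ∀ p : G × G, ‖comul (E.lift f) p‖ ≤ ‖f‖ := fun p => f.norm_coe_le_norm _
      have h1 : ∀ p : G × G, ‖E.idProd (comul (E.lift f)) p‖ ≤ ‖f‖ := fun p =>
        ((E.P _).norm_coe_le_norm _).trans ((E.norm_apply_le _).trans
          ((BoundedContinuousFunction.norm_le (norm_nonneg f)).2 fun _ => h0 _))
      exact ((E.P _).norm_coe_le_norm _).trans ((E.norm_apply_le _).trans
          ((BoundedContinuousFunction.norm_le (norm_nonneg f)).2 fun _ => h1 _)))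

lemma norm_comulQ_le (E : HypergroupExpectation G) (f : E.Q →ᵇ ℂ) : ‖E.comulQ f‖ ≤ ‖f‖ :=
  BoundedContinuousFunction.norm_ofNormedAddCommGroup_le _ (norm_nonneg f) _

lemma comulQ_φ (E : HypergroupExpectation G) (f : E.Q →ᵇ ℂ) (p q : G) :
    E.comulQ f (E.φ p, E.φ q) = E.prodId (E.idProd (comul (E.lift f))) (p, q) :=
  E.prod_comul_eq _ (E.φ_sec _) (E.φ_sec _)

lemma comulQ_φ' (E : HypergroupExpectation G) (f : E.Q →ᵇ ℂ) (p q : G) :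
    E.comulQ f (E.φ p, E.φ q) = E.P (sliceRight (comul (E.P (E.lift f))) p) q := by
  rw [comulQ_φ, ← E.idProd_comul]
  rfl

lemma comulQ_add (E : HypergroupExpectation G) (f g : E.Q →ᵇ ℂ) :
    E.comulQ (f + g) = E.comulQ f + E.comulQ g := by
  ext z
  obtain ⟨⟨p, q⟩, rfl⟩ := (E.surjective_φ.prodMap E.surjective_φ) z
  simp only [Prod.map_apply, BoundedContinuousFunction.coe_add, Pi.add_apply, comulQ_φ']
  have h : sliceRight (comul (E.P (E.lift (f + g)))) p =
      sliceRight (comul (E.P (E.lift f))) p + sliceRight (comul (E.P (E.lift g))) p := by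
    have : E.lift (f + g) = E.lift f + E.lift g := rfl
    rw [this, map_add]
    rfl
  rw [h, map_add]
  rfl

lemma comulQ_smul (E : HypergroupExpectation G) (c : ℂ) (f : E.Q →ᵇ ℂ) :
    E.comulQ (c • f) = c • E.comulQ f := by
  ext z
  obtain ⟨⟨p, q⟩, rfl⟩ := (E.surjective_φ.prodMap E.surjective_φ) z
  simp only [Prod.map_apply, BoundedContinuousFunction.coe_smul, comulQ_φ']
  have h : sliceRight (comul (E.P (E.lift (c • f)))) p =
      c • sliceRight (comul (E.P (E.lift f))) p := by
    have : E.lift (c • f) = c • E.lift f := rfl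
    rw [this, map_smul]
    rfl
  rw [h, map_smul]
  rfl

/-- On a compact set, `Δ̃ f` depends only on the values of `f` on some compact set. -/
lemma comulQ_compact_control (E : HypergroupExpectation G) {K L : Set E.Q} (hK : IsCompact K)
    (hL : IsCompact L) : ∃ M : Set E.Q, IsCompact M ∧ ∀ f : E.Q →ᵇ ℂ, (∀ x ∈ M, f x = 0) →
      ∀ x ∈ K, ∀ y ∈ L, E.comulQ f (x, y) = 0 := by
  obtain ⟨K', hK', h1⟩ := E.exists_compact_control (E.isProperMap_φ.isCompact_preimage hK)
  obtain ⟨L', hL', h2⟩ := E.exists_compact_control (E.isProperMap_φ.isCompact_preimage hL)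
  refine ⟨E.φ '' ((fun z : G × G => z.1 * z.2) '' (K' ×ˢ L')),
    ((hK'.prod hL').image (by fun_prop)).image E.continuous_φ, fun f hf x hx y hy => ?_⟩
  obtain ⟨p, rfl⟩ := E.surjective_φ x
  obtain ⟨q, rfl⟩ := E.surjective_φ y
  rw [comulQ_φ]
  refine h1 _ (fun p' hp' => ?_) p hx
  refine h2 _ (fun q' hq' => ?_) q hy
  exact hf _ ⟨p' * q', ⟨(p', q'), ⟨hp', hq'⟩, rfl⟩, rfl⟩

/-- `b̌ (p) = b (p⁻¹)` for `b ∈ B`. -/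
def checkB (E : HypergroupExpectation G) (b : E.B) : E.B :=
  ⟨⟨⟨fun p => b.1 p⁻¹, by fun_prop⟩,
    (zero_at_infty b.1).comp (Homeomorph.inv G).isClosedEmbedding.tendsto_cocompact⟩, by
    obtain ⟨f, hf⟩ := b.2
    refine ⟨⟨⟨fun p => f p⁻¹, by fun_prop⟩,
      (zero_at_infty f).comp (Homeomorph.inv G).isClosedEmbedding.tendsto_cocompact⟩, ?_⟩
    have := E.map_check f.toBCF
    rw [hf] at this
    exact this⟩

@[simp] lemma checkB_apply (E : HypergroupExpectation G) (b : E.B) (p : G) :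
    (E.checkB b).1 p = b.1 p⁻¹ := rfl

lemma norm_checkB_le (E : HypergroupExpectation G) (b : E.B) :
    ‖(E.checkB b : C₀(G, ℂ))‖ ≤ ‖(b : C₀(G, ℂ))‖ :=
  (BoundedContinuousFunction.norm_le (f := ZeroAtInftyContinuousMap.toBCF (E.checkB b).1)
    (norm_nonneg (b : C₀(G, ℂ)))).2 fun p => b.1.toBCF.norm_coe_le_norm p⁻¹

/-- The involution `s ↦ š` of `Q`, `š (b) = s (b̌)`. -/
def inv (E : HypergroupExpectation G) (s : E.Q) : E.Q :=
  ⟨{  toFun := fun b => s (E.checkB b)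
      map_add' := fun a b => E.apply_add s (E.checkB a) (E.checkB b)
      map_smul' := fun c a => E.apply_smul s c (E.checkB a)
      cont := by
        have h : Continuous E.checkB := by
          refine LipschitzWith.continuous (K := 1) (LipschitzWith.of_dist_le_mul fun a b => ?_)
          rw [NNReal.coe_one, one_mul, Subtype.dist_eq, Subtype.dist_eq, dist_eq_norm, dist_eq_norm]
          exact E.norm_checkB_le (a - b)
        exact s.1.cont.comp h }, by
    constructor
    · intro h
      obtain ⟨b, hb⟩ := E.exists_ne_zero s
      have h1 : s (E.checkB (E.checkB b)) = 0 := DFunLike.congr_fun h (E.checkB b)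
      have h2 : E.checkB (E.checkB b) = b := by
        ext p
        simp
      exact hb (h2 ▸ h1)
    · intro a b
      exact E.apply_mul s (E.checkB a) (E.checkB b)⟩

@[simp] lemma inv_apply (E : HypergroupExpectation G) (s : E.Q) (b : E.B) :
    E.inv s b = s (E.checkB b) := rfl

lemma inv_φ (E : HypergroupExpectation G) (p : G) : E.inv (E.φ p) = E.φ p⁻¹ := rfl

@[fun_prop] lemma continuous_inv (E : HypergroupExpectation G) : Continuous E.inv :=
  Continuous.subtype_mk (WeakDual.continuous_of_continuous_eval fun b =>
    E.continuous_apply (E.checkB b)) _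

end HypergroupExpectation

/-! ### Bounded Radon measures -/

/-- The space `M_b(X)` of bounded complex Radon measures on a locally compact space `X`, a measure `μ`
being given by its values `⟨f, μ⟩` on the bounded continuous functions: the Radon measures are the
bounded functionals on `C_b(X)` that are tight, i.e. concentrated on a compact set up to an
arbitrarily small `ε`. -/
def radonMeasures (X : Type*) [TopologicalSpace X] : Submodule ℂ ((X →ᵇ ℂ) →L[ℂ] ℂ) where
  carrier := {μ | ∀ ε : ℝ, 0 < ε → ∃ K : Set X, IsCompact K ∧
    ∀ f : X →ᵇ ℂ, (∀ x ∈ K, f x = 0) → ‖μ f‖ ≤ ε * ‖f‖}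
  zero_mem' := fun ε hε => ⟨∅, isCompact_empty, fun f _ => by
    simpa using mul_nonneg hε.le (norm_nonneg f)⟩
  add_mem' := by
    intro μ ν hμ hν ε hε
    obtain ⟨K, hK, h1⟩ := hμ (ε / 2) (half_pos hε)
    obtain ⟨L, hL, h2⟩ := hν (ε / 2) (half_pos hε)
    refine ⟨K ∪ L, hK.union hL, fun f hf => ?_⟩
    have h3 := h1 f fun x hx => hf x (Or.inl hx)
    have h4 := h2 f fun x hx => hf x (Or.inr hx)
    calc ‖(μ + ν) f‖ ≤ ‖μ f‖ + ‖ν f‖ := norm_add_le _ _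
      _ ≤ ε * ‖f‖ := by linarith
  smul_mem' := by
    intro c μ hμ ε hε
    obtain ⟨K, hK, h1⟩ := hμ (ε / (‖c‖ + 1)) (by positivity)
    refine ⟨K, hK, fun f hf => ?_⟩
    calc ‖(c • μ) f‖ = ‖c‖ * ‖μ f‖ := norm_smul c (μ f)
      _ ≤ (‖c‖ + 1) * (ε / (‖c‖ + 1) * ‖f‖) := by
          gcongr
          · linarith
          · exact h1 f hf
      _ = ε * ‖f‖ := by field_simp

/-- The type of bounded complex Radon measures on `X`. -/
abbrev Mb (X : Type*) [TopologicalSpace X] : Type _ := radonMeasures X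

namespace Mb

variable {X Y : Type*} [TopologicalSpace X] [TopologicalSpace Y]

/-- The pairing `⟨f, μ⟩` is continuous, on bounded sets, for uniform convergence on compact sets. -/
lemma exists_bound (μ : Mb X) {ε : ℝ} (hε : 0 < ε) (M : ℝ) : ∃ K : Set X, IsCompact K ∧
    ∃ η > 0, ∀ f : X →ᵇ ℂ, ‖f‖ ≤ M → (∀ x ∈ K, ‖f x‖ ≤ η) → ‖μ.1 f‖ ≤ ε := by
  obtain ⟨K, hK, h1⟩ := μ.2 (ε / (2 * (|M| + 1))) (by positivity)
  set η : ℝ := ε / (4 * (‖μ.1‖ + 1)) with hη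
  have hη0 : 0 < η := by positivity
  refine ⟨K, hK, η, hη0, fun f hfM hf => ?_⟩
  -- cut off the small values of `f`
  let c : X → ℝ := fun x => min 1 (max 0 (‖f x‖ / η - 1))
  have hc : Continuous c := by fun_prop
  have hc0 : ∀ x, 0 ≤ c x := fun x => le_min zero_le_one (le_max_left _ _)
  have hc1 : ∀ x, c x ≤ 1 := fun x => min_le_left _ _
  have hcn : ∀ x, ‖f x * (c x : ℂ)‖ ≤ ‖f x‖ := by
    intro x
    rw [norm_mul, Complex.norm_real, Real.norm_of_nonneg (hc0 x)]
    exact mul_le_of_le_one_right (norm_nonneg _) (hc1 x)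
  let g : X →ᵇ ℂ := BoundedContinuousFunction.ofNormedAddCommGroup (fun x => f x * (c x : ℂ))
    (by fun_prop) ‖f‖ (fun x => (hcn x).trans (f.norm_coe_le_norm x))
  have hgK : ∀ x ∈ K, g x = 0 := by
    intro x hx
    have h2 : ‖f x‖ / η - 1 ≤ 0 := by
      rw [sub_nonpos, div_le_one hη0]
      exact hf x hx
    have h3 : c x = 0 := by simp [c, max_eq_left h2]
    change f x * (c x : ℂ) = 0
    simp [h3]
  have hgn : ‖g‖ ≤ ‖f‖ := BoundedContinuousFunction.norm_ofNormedAddCommGroup_le _ (norm_nonneg f) _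
  have hfg : ‖f - g‖ ≤ 2 * η := by
    rw [BoundedContinuousFunction.norm_le (by positivity)]
    intro x
    have h2 : (f - g) x = f x * ((1 - c x : ℝ) : ℂ) := by
      change f x - f x * (c x : ℂ) = _
      push_cast
      ring
    rw [h2, norm_mul, Complex.norm_real, Real.norm_of_nonneg (by linarith [hc1 x])]
    by_cases h3 : ‖f x‖ ≤ 2 * η
    · exact (mul_le_of_le_one_right (norm_nonneg _) (by linarith [hc0 x])).trans h3
    · have h4 : 1 ≤ ‖f x‖ / η - 1 := by
        rw [le_sub_iff_add_le, le_div_iff₀ hη0]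
        linarith
      have h5 : c x = 1 := min_eq_left (h4.trans (le_max_right _ _))
      rw [h5]
      simp
      positivity
  have h6 : ‖μ.1 g‖ ≤ ε / 2 := by
    calc ‖μ.1 g‖ ≤ ε / (2 * (|M| + 1)) * ‖g‖ := h1 g hgK
      _ ≤ ε / (2 * (|M| + 1)) * (|M| + 1) := by
        gcongr
        have := le_abs_self M
        linarith
      _ = ε / 2 := by field_simp
  have h7 : ‖μ.1 (f - g)‖ ≤ ε / 2 := by
    calc ‖μ.1 (f - g)‖ ≤ ‖μ.1‖ * ‖f - g‖ := μ.1.le_opNorm _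
      _ ≤ (‖μ.1‖ + 1) * (2 * η) := by
        gcongr
        linarith
      _ = ε / 2 := by rw [hη]; field_simp; norm_num
  calc ‖μ.1 f‖ = ‖μ.1 g + μ.1 (f - g)‖ := by rw [← map_add]; congr 2; abel
    _ ≤ ε := (norm_add_le _ _).trans (by linarith)

/-- The function `x ↦ ∫ F (x, y) dν(y)`. -/
def partialPairing (ν : Mb Y) (F : X × Y →ᵇ ℂ) : X →ᵇ ℂ :=
  have hs : ∀ x, ‖sliceRight F x‖ ≤ ‖F‖ := fun x =>
    (BoundedContinuousFunction.norm_le (norm_nonneg F)).2 fun _ => F.norm_coe_le_norm _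
  BoundedContinuousFunction.ofNormedAddCommGroup (fun x => ν.1 (sliceRight F x))
    (by
      rw [continuous_iff_continuousAt]
      intro x₀
      rw [ContinuousAt, Metric.tendsto_nhds]
      intro ε hε
      obtain ⟨K, hK, η, hη, h1⟩ := ν.exists_bound (half_pos hε) (‖F‖ + ‖F‖)
      have hF : Continuous fun z : Y × X => F (z.2, z.1) := by fun_prop
      filter_upwards [slice_uniform hF hK x₀ hη] with x hx
      rw [dist_eq_norm, ← map_sub]
      refine lt_of_le_of_lt (h1 _ ((norm_sub_le _ _).trans (add_le_add (hs _) (hs _))) ?_)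
        (half_lt_self hε)
      exact fun y hy => (hx y hy).le)
    (‖ν.1‖ * ‖F‖) (fun x => (ν.1.le_opNorm _).trans (by gcongr; exact hs x))

@[simp] lemma partialPairing_apply (ν : Mb Y) (F : X × Y →ᵇ ℂ) (x : X) :
    ν.partialPairing F x = ν.1 (sliceRight F x) := rfl

lemma norm_partialPairing_le (ν : Mb Y) (F : X × Y →ᵇ ℂ) :
    ‖ν.partialPairing F‖ ≤ ‖ν.1‖ * ‖F‖ :=
  (BoundedContinuousFunction.norm_le (by positivity)).2 fun x => (ν.1.le_opNorm _).trans (by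
    gcongr
    exact (BoundedContinuousFunction.norm_le (norm_nonneg F)).2 fun _ => F.norm_coe_le_norm _)

/-- The product measure `μ ⊗ ν`. -/
def tensor (μ : Mb X) (ν : Mb Y) : Mb (X × Y) :=
  ⟨LinearMap.mkContinuous
    { toFun := fun F => μ.1 (ν.partialPairing F)
      map_add' := fun F F' => by
        have : ν.partialPairing (F + F') = ν.partialPairing F + ν.partialPairing F' := by
          ext x
          exact ν.1.map_add (sliceRight F x) (sliceRight F' x)
        rw [this, map_add]
      map_smul' := fun c F => by
        have : ν.partialPairing (c • F) = c • ν.partialPairing F := by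
          ext x
          exact ν.1.map_smul c (sliceRight F x)
        rw [this, map_smul]
        rfl } (‖μ.1‖ * ‖ν.1‖) (fun F => by
      rw [mul_assoc]
      exact (μ.1.le_opNorm _).trans (by gcongr; exact ν.norm_partialPairing_le F)), by
    intro ε hε
    obtain ⟨K, hK, η, hη, h1⟩ := μ.exists_bound hε ‖ν.1‖
    obtain ⟨L, hL, h2⟩ := ν.2 η hη
    refine ⟨K ×ˢ L, hK.prod hL, fun F hF => ?_⟩
    have hs : ∀ x, ‖sliceRight F x‖ ≤ ‖F‖ := fun x =>
      (BoundedContinuousFunction.norm_le (norm_nonneg F)).2 fun _ => F.norm_coe_le_norm _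
    rw [LinearMap.mkContinuous_apply]
    change ‖μ.1 (ν.partialPairing F)‖ ≤ ε * ‖F‖
    rcases (norm_nonneg F).eq_or_lt with h0 | h0
    · have : F = 0 := norm_eq_zero.1 h0.symm
      subst this
      have h3 : ν.partialPairing (0 : X × Y →ᵇ ℂ) = 0 := by
        ext x
        exact ν.1.map_zero
      simp [h3]
    · have h4 := h1 ((‖F‖⁻¹ : ℂ) • ν.partialPairing F) ?_ ?_
      · rw [map_smul, norm_smul, norm_inv, Complex.norm_real, norm_norm, inv_mul_le_iff₀ h0] at h4
        linarith
      · rw [norm_smul, norm_inv, Complex.norm_real, norm_norm, inv_mul_le_iff₀ h0]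
        linarith [ν.norm_partialPairing_le F]
      · intro x hx
        have h5 := h2 (sliceRight F x) fun y hy => hF (x, y) ⟨hx, hy⟩
        change ‖(‖F‖⁻¹ : ℂ) • ν.partialPairing F x‖ ≤ η
        rw [norm_smul, norm_inv, Complex.norm_real, norm_norm, inv_mul_le_iff₀ h0,
          partialPairing_apply]
        calc _ ≤ η * ‖sliceRight F x‖ := h5
          _ ≤ η * ‖F‖ := by gcongr; exact hs x
          _ = ‖F‖ * η := mul_comm _ _⟩

@[simp] lemma tensor_apply (μ : Mb X) (ν : Mb Y) (F : X × Y →ᵇ ℂ) :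
    (μ.tensor ν).1 F = μ.1 (ν.partialPairing F) := rfl

/-- The linear extension `δ : M_b(X) → M_b(X × X)` of `ε_s ↦ ε_s ⊗ ε_s`:
`⟨F, δ μ⟩ = ∫ F (s, s) dμ(s)`. -/
def δ (X : Type*) [TopologicalSpace X] : Mb X →ₗ[ℂ] Mb (X × X) where
  toFun μ := ⟨LinearMap.mkContinuous
    { toFun := fun F => μ.1 (F.compContinuous ⟨fun s => (s, s), by fun_prop⟩)
      map_add' := fun F F' => μ.1.map_add (F.compContinuous ⟨fun s => (s, s), by fun_prop⟩)
        (F'.compContinuous ⟨fun s => (s, s), by fun_prop⟩)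
      map_smul' := fun c F => μ.1.map_smul c (F.compContinuous ⟨fun s => (s, s), by fun_prop⟩) }
      ‖μ.1‖ (fun F => (μ.1.le_opNorm _).trans (by
        gcongr
        exact (BoundedContinuousFunction.norm_le (norm_nonneg F)).2
          fun _ => F.norm_coe_le_norm _)), by
    intro ε hε
    obtain ⟨K, hK, h1⟩ := μ.2 ε hε
    refine ⟨K ×ˢ K, hK.prod hK, fun F hF => ?_⟩
    refine (h1 _ fun x hx => hF (x, x) ⟨hx, hx⟩).trans ?_
    gcongr
    exact (BoundedContinuousFunction.norm_le (norm_nonneg F)).2 fun _ => F.norm_coe_le_norm _⟩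
  map_add' _ _ := rfl
  map_smul' _ _ := rfl

end Mb

namespace HypergroupExpectation

variable {G : Type*} [TopologicalSpace G] [Group G] [IsTopologicalGroup G]
  [LocallyCompactSpace G] [T2Space G]

/-- The convolution on `M_b(Q)`: `⟨f, μ * ν⟩ = ∫∫ (Δ̃ f)(s, t) dμ(s) dν(t)`. -/
instance (E : HypergroupExpectation G) : Mul (Mb E.Q) where
  mul μ ν := ⟨LinearMap.mkContinuous
    { toFun := fun f => (μ.tensor ν).1 (E.comulQ f)
      map_add' := fun f g => by rw [E.comulQ_add, map_add]
      map_smul' := fun c f => by rw [E.comulQ_smul, map_smul]; rfl }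
      ‖(μ.tensor ν).1‖ (fun f => ((μ.tensor ν).1.le_opNorm _).trans (by
        gcongr
        exact E.norm_comulQ_le f)), by
    intro ε hε
    obtain ⟨S, hS, h1⟩ := (μ.tensor ν).2 ε hε
    obtain ⟨M, hM, h2⟩ := E.comulQ_compact_control (hS.image continuous_fst)
      (hS.image continuous_snd)
    refine ⟨M, hM, fun f hf => (h1 _ fun z hz => ?_).trans ?_⟩
    · exact h2 f hf z.1 ⟨z, hz, rfl⟩ z.2 ⟨z, hz, rfl⟩
    · gcongr
      exact E.norm_comulQ_le f⟩

/-- The involution on `M_b(Q)`: `μ⋆ (f)` is the complex conjugate of `μ̌ (f̄)`, where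
`⟨f, μ̌⟩ = ⟨f̌, μ⟩` and `f̌ (s) = f (š)`. -/
instance (E : HypergroupExpectation G) : Star (Mb E.Q) where
  star μ := ⟨LinearMap.mkContinuous
    { toFun := fun f => star (μ.1 ((star f).compContinuous ⟨E.inv, E.continuous_inv⟩))
      map_add' := fun f g => by
        have h : (star (f + g)).compContinuous ⟨E.inv, E.continuous_inv⟩ =
            (star f).compContinuous ⟨E.inv, E.continuous_inv⟩ +
              (star g).compContinuous ⟨E.inv, E.continuous_inv⟩ := by
          rw [star_add]; rfl
        rw [h, map_add, star_add]
      map_smul' := fun c f => by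
        have h : (star (c • f)).compContinuous ⟨E.inv, E.continuous_inv⟩ =
            star c • (star f).compContinuous ⟨E.inv, E.continuous_inv⟩ := by
          rw [star_smul]; rfl
        rw [h, map_smul, star_smul, star_star]
        rfl }
      ‖μ.1‖ (fun f => by
        rw [LinearMap.coe_mk, AddHom.coe_mk, norm_star]
        refine (μ.1.le_opNorm _).trans ?_
        gcongr
        refine (BoundedContinuousFunction.norm_le (norm_nonneg f)).2 fun x => ?_
        exact (norm_star (f (E.inv x))).trans_le (f.norm_coe_le_norm _)), by
    intro ε hε
    obtain ⟨K, hK, h1⟩ := μ.2 ε hε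
    refine ⟨E.inv '' K, hK.image E.continuous_inv, fun f hf => ?_⟩
    rw [LinearMap.mkContinuous_apply, LinearMap.coe_mk, AddHom.coe_mk, norm_star]
    refine (h1 _ fun x hx => ?_).trans ?_
    · change star (f (E.inv x)) = 0
      rw [hf _ ⟨x, hx, rfl⟩, star_zero]
    · gcongr
      refine (BoundedContinuousFunction.norm_le (norm_nonneg f)).2 fun x => ?_
      exact (norm_star (f (E.inv x))).trans_le (f.norm_coe_le_norm _)⟩

lemma mul_apply_apply (E : HypergroupExpectation G) (μ ν : Mb E.Q) (f : E.Q →ᵇ ℂ) :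
    (μ * ν).1 f = (μ.tensor ν).1 (E.comulQ f) := rfl

lemma star_apply_apply (E : HypergroupExpectation G) (μ : Mb E.Q) (f : E.Q →ᵇ ℂ) :
    (star μ).1 f = star (μ.1 ((star f).compContinuous ⟨E.inv, E.continuous_inv⟩)) := rfl

end HypergroupExpectation

/-! ### Integrals of operator-valued functions -/

/-- A weakly continuous family of contractions on a Hilbert space. -/
structure ContractionFamily (X H : Type*) [TopologicalSpace X] [NormedAddCommGroup H]
    [InnerProductSpace ℂ H] where
  /-- the operators -/
  op : X → H →L[ℂ] H
  norm_op_le : ∀ x, ‖op x‖ ≤ 1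
  continuous_inner : ∀ ξ η, Continuous fun x => ⟪ξ, op x η⟫_ℂ

lemma norm_inner_op_le {H : Type*} [NormedAddCommGroup H] [InnerProductSpace ℂ H] {T : H →L[ℂ] H}
    (hT : ‖T‖ ≤ 1) (ξ η : H) : ‖⟪ξ, T η⟫_ℂ‖ ≤ ‖ξ‖ * ‖η‖ :=
  (norm_inner_le_norm _ _).trans (by
    gcongr
    exact (T.le_opNorm η).trans (mul_le_of_le_one_left (norm_nonneg _) hT))

/-- Weak continuity of a family of contractions can be tested on a dense set. -/
lemma continuous_inner_of_dense {X H : Type*} [TopologicalSpace X] [NormedAddCommGroup H]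
    [InnerProductSpace ℂ H] {U : X → H →L[ℂ] H} (hU : ∀ x, ‖U x‖ ≤ 1) {D : Set H} (hD : Dense D)
    (h : ∀ ξ ∈ D, ∀ η ∈ D, Continuous fun x => ⟪ξ, U x η⟫_ℂ) (ξ η : H) :
    Continuous fun x => ⟪ξ, U x η⟫_ℂ := by
  refine continuous_of_uniform_approx_of_continuous fun u hu => ?_
  obtain ⟨ε, hε, hεu⟩ := Metric.mem_uniformity_dist.1 hu
  obtain ⟨η', hη'D, hη'⟩ := hD.exists_dist_lt η (show 0 < ε / (2 * (‖ξ‖ + 1)) by positivity)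
  obtain ⟨ξ', hξ'D, hξ'⟩ := hD.exists_dist_lt ξ (show 0 < ε / (2 * (‖η'‖ + 1)) by positivity)
  refine ⟨fun x => ⟪ξ', U x η'⟫_ℂ, h ξ' hξ'D η' hη'D, fun x => hεu ?_⟩
  rw [dist_eq_norm] at hη' hξ' ⊢
  have e : ⟪ξ, U x η⟫_ℂ - ⟪ξ', U x η'⟫_ℂ = ⟪ξ, U x (η - η')⟫_ℂ + ⟪ξ - ξ', U x η'⟫_ℂ := by
    rw [map_sub, inner_sub_right, inner_sub_left]
    ring
  rw [e]
  have h1 := norm_inner_op_le (hU x) ξ (η - η')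
  have h2 := norm_inner_op_le (hU x) (ξ - ξ') η'
  have h3 : ‖ξ‖ * ‖η - η'‖ ≤ ε / 2 := by
    calc ‖ξ‖ * ‖η - η'‖ ≤ (‖ξ‖ + 1) * (ε / (2 * (‖ξ‖ + 1))) := by
          gcongr
          linarith
      _ = ε / 2 := by field_simp
  have h4 : ‖ξ - ξ'‖ * ‖η'‖ < ε / 2 := by
    calc ‖ξ - ξ'‖ * ‖η'‖ ≤ ‖ξ - ξ'‖ * (‖η'‖ + 1) := by gcongr; linarith
      _ < (ε / (2 * (‖η'‖ + 1))) * (‖η'‖ + 1) := by gcongr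
      _ = ε / 2 := by field_simp
  exact (norm_add_le _ _).trans_lt (by linarith)

namespace ContractionFamily

variable {X Y H K : Type*} [TopologicalSpace X] [TopologicalSpace Y]
  [NormedAddCommGroup H] [InnerProductSpace ℂ H] [NormedAddCommGroup K] [InnerProductSpace ℂ K]

/-- The matrix coefficient `x ↦ ⟪ξ, U x η⟫`. -/
def coeff (U : ContractionFamily X H) (ξ η : H) : X →ᵇ ℂ :=
  BoundedContinuousFunction.ofNormedAddCommGroup (fun x => ⟪ξ, U.op x η⟫_ℂ)
    (U.continuous_inner ξ η) (‖ξ‖ * ‖η‖) (fun x => norm_inner_op_le (U.norm_op_le x) ξ η)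

@[simp] lemma coeff_apply (U : ContractionFamily X H) (ξ η : H) (x : X) :
    U.coeff ξ η x = ⟪ξ, U.op x η⟫_ℂ := rfl

lemma norm_coeff_le (U : ContractionFamily X H) (ξ η : H) : ‖U.coeff ξ η‖ ≤ ‖ξ‖ * ‖η‖ :=
  (BoundedContinuousFunction.norm_le (by positivity)).2
    fun x => norm_inner_op_le (U.norm_op_le x) ξ η

/-- The sesquilinear form `(ξ, η) ↦ ∫ ⟪ξ, U x η⟫ dμ(x)`. -/
def form (U : ContractionFamily X H) (μ : Mb X) : H →L⋆[ℂ] H →L[ℂ] ℂ :=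
  LinearMap.mkContinuous₂ (LinearMap.mk₂'ₛₗ (starRingEnd ℂ) (RingHom.id ℂ)
    (fun ξ η => μ.1 (U.coeff ξ η))
    (fun ξ ξ' η => by
      rw [← map_add]
      congr 1
      ext x
      simp)
    (fun c ξ η => by
      rw [smul_eq_mul, ← smul_eq_mul, ← map_smul]
      congr 1
      ext x
      simp [mul_comm])
    (fun ξ η η' => by
      rw [← map_add]
      congr 1
      ext x
      simp)
    (fun c ξ η => by
      rw [RingHom.id_apply, ← map_smul]
      congr 1
      ext x
      simp)) ‖μ.1‖ (fun ξ η => by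
    rw [mul_assoc]
    exact (μ.1.le_opNorm _).trans (by gcongr; exact U.norm_coeff_le ξ η))

/-- The weak integral `∫ U x dμ(x)`: the operator `T` with `⟪ξ, T η⟫ = ∫ ⟪ξ, U x η⟫ dμ(x)`. -/
def integral [CompleteSpace H] (U : ContractionFamily X H) : Mb X →ₗ[ℂ] (H →L[ℂ] H) :=
  have key : ∀ (μ : Mb X) (ξ η : H), ⟪ξ, ContinuousLinearMap.adjoint
      (InnerProductSpace.continuousLinearMapOfBilin (U.form μ)) η⟫_ℂ = μ.1 (U.coeff ξ η) := by
    intro μ ξ η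
    rw [ContinuousLinearMap.adjoint_inner_right,
      InnerProductSpace.continuousLinearMapOfBilin_apply]
    rfl
  { toFun := fun μ => ContinuousLinearMap.adjoint
      (InnerProductSpace.continuousLinearMapOfBilin (U.form μ))
    map_add' := fun μ ν => by
      ext η
      refine ext_inner_left ℂ fun ξ => ?_
      rw [add_apply, inner_add_right, key, key, key]
      rfl
    map_smul' := fun c μ => by
      ext η
      refine ext_inner_left ℂ fun ξ => ?_
      rw [RingHom.id_apply, smul_apply, inner_smul_right, key, key]
      rfl }

lemma inner_integral [CompleteSpace H] (U : ContractionFamily X H) (μ : Mb X) (ξ η : H) :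
    ⟪ξ, U.integral μ η⟫_ℂ = μ.1 (U.coeff ξ η) := by
  change ⟪ξ, ContinuousLinearMap.adjoint
      (InnerProductSpace.continuousLinearMapOfBilin (U.form μ)) η⟫_ℂ = μ.1 (U.coeff ξ η)
  rw [ContinuousLinearMap.adjoint_inner_right,
    InnerProductSpace.continuousLinearMapOfBilin_apply]
  rfl

/-- The family `(x, y) ↦ U x ⊗ V y` on the Hilbert space tensor product. -/
def tensor (U : ContractionFamily X H) (V : ContractionFamily Y K) :
    ContractionFamily (X × Y) (UniformSpace.Completion (H ⊗[ℂ] K)) :=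
  have hle : ∀ z : X × Y, ‖(TensorProduct.mapL (U.op z.1) (V.op z.2)).completion‖ ≤ 1 := by
    intro z
    have h1 : ‖TensorProduct.mapL (U.op z.1) (V.op z.2)‖ ≤ 1 :=
      (TensorProduct.norm_mapL_le _ _).trans
        (mul_le_one₀ (U.norm_op_le _) (norm_nonneg _) (V.norm_op_le _))
    refine ContinuousLinearMap.opNorm_le_bound _ zero_le_one fun ξ => ?_
    rw [one_mul]
    induction ξ using UniformSpace.Completion.induction_on with
    | hp => exact isClosed_le (by fun_prop) (by fun_prop)
    | ih ξ =>
      rw [ContinuousLinearMap.completion_apply_coe, UniformSpace.Completion.norm_coe,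
        UniformSpace.Completion.norm_coe]
      exact (ContinuousLinearMap.le_opNorm _ _).trans (mul_le_of_le_one_left (norm_nonneg _) h1)
  { op := fun z => (TensorProduct.mapL (U.op z.1) (V.op z.2)).completion
    norm_op_le := hle
    continuous_inner := by
      refine continuous_inner_of_dense hle (UniformSpace.Completion.denseRange_coe (α := H ⊗[ℂ] K)) ?_
      rintro _ ⟨ξ, rfl⟩ _ ⟨η, rfl⟩
      simp only [ContinuousLinearMap.completion_apply_coe, UniformSpace.Completion.inner_coe]
      induction ξ with
      | zero => simpa using continuous_const
      | add a b ha hb =>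
        simp only [inner_add_left]
        exact ha.add hb
      | tmul a b =>
        induction η with
        | zero => simpa using continuous_const
        | add c d hc hd =>
          simp only [map_add, inner_add_right]
          exact hc.add hd
        | tmul c d =>
          simp only [TensorProduct.mapL_tmul, TensorProduct.inner_tmul]
          exact ((U.continuous_inner a c).comp continuous_fst).mul
            ((V.continuous_inner b d).comp continuous_snd) }

end ContractionFamily

/-! ### The regular representation of the hypergroup -/

namespace HypergroupExpectation

open MeasureTheory

variable {G : Type*} [TopologicalSpace G] [Group G] [IsTopologicalGroup G]
  [LocallyCompactSpace G] [T2Space G]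

/-- The space `𝒦(Q)` of continuous functions on `Q` with compact support. -/
def 𝒦 (E : HypergroupExpectation G) : Submodule ℂ (E.Q →ᵇ ℂ) where
  carrier := {f | HasCompactSupport f}
  zero_mem' := HasCompactSupport.zero
  add_mem' := fun hf hg => HasCompactSupport.add hf hg
  smul_mem' := fun c f hf => by
    have h : HasCompactSupport fun x => c • f x := hf.comp_left (g := fun z => c • z) (smul_zero c)
    exact h

lemma lift_hasCompactSupport (E : HypergroupExpectation G) (f : E.𝒦) :
    HasCompactSupport (E.lift f.1) := by
  have h : HasCompactSupport f.1 := f.2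
  refine HasCompactSupport.intro (E.isProperMap_φ.isCompact_preimage h.isCompact) fun p hp => ?_
  exact image_eq_zero_of_notMem_tsupport (f := f.1) hp

/-- Left translation on `𝒦(Q)`: `(λ_Q(ε_s) f)(t) = ⟨f, ε_š * ε_t⟩ = (Δ̃ f)(š, t)`. -/
def translate (E : HypergroupExpectation G) (s : E.Q) : E.𝒦 →ₗ[ℂ] E.𝒦 where
  toFun f := ⟨sliceRight (E.comulQ f.1) (E.inv s), by
    obtain ⟨p, rfl⟩ := E.surjective_φ s
    have h := E.map_hasCompactSupport (hasCompactSupport_slice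
      (E.map_hasCompactSupport (E.lift_hasCompactSupport f)) p⁻¹)
    refine HasCompactSupport.intro (h.isCompact.image E.continuous_φ) fun t ht => ?_
    obtain ⟨q, rfl⟩ := E.surjective_φ t
    change E.comulQ f.1 (E.φ p⁻¹, E.φ q) = 0
    rw [E.comulQ_φ']
    exact image_eq_zero_of_notMem_tsupport fun hq => ht ⟨q, hq, rfl⟩⟩
  map_add' f g := by
    apply Subtype.ext
    ext t
    exact DFunLike.congr_fun (E.comulQ_add f.1 g.1) (E.inv s, t)
  map_smul' c f := by
    apply Subtype.ext
    ext t
    exact DFunLike.congr_fun (E.comulQ_smul c f.1) (E.inv s, t)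

@[simp] lemma translate_apply (E : HypergroupExpectation G) (s : E.Q) (f : E.𝒦) (t : E.Q) :
    (E.translate s f).1 t = E.comulQ f.1 (E.inv s, t) := rfl

variable [MeasurableSpace G] [BorelSpace G]

/-- The condition `m ∘ P = m` (on `𝒦(G)`). -/
def Preserves (E : HypergroupExpectation G) (m : Measure G) : Prop :=
  ∀ f : G →ᵇ ℂ, HasCompactSupport f → ∫ p, E.P f p ∂m = ∫ p, f p ∂m

/-- The measure `m̃ = φ_* m` on `Q`. -/
def mQ (E : HypergroupExpectation G) (m : Measure G) : Measure E.Q := m.map E.φ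

instance (E : HypergroupExpectation G) (m : Measure G) [IsFiniteMeasureOnCompacts m] :
    IsFiniteMeasureOnCompacts (E.mQ m) where
  lt_top_of_isCompact := by
    intro K hK
    rw [mQ, Measure.map_apply E.continuous_φ.measurable hK.measurableSet]
    exact (E.isProperMap_φ.isCompact_preimage hK).measure_lt_top

/-- The Hilbert space `L₂(Q) = L₂(Q, m̃)`. -/
abbrev L2 (E : HypergroupExpectation G) (m : Measure G) : Type _ := Lp ℂ 2 (E.mQ m)

/-- The inclusion of `𝒦(Q)` in `L₂(Q)`. -/
def incl (E : HypergroupExpectation G) (m : Measure G) [IsFiniteMeasureOnCompacts m] :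
    E.𝒦 →ₗ[ℂ] E.L2 m where
  toFun f := (f.1.continuous.memLp_of_hasCompactSupport (p := 2) f.2).toLp f.1
  map_add' _ _ := rfl
  map_smul' _ _ := rfl

/-- `P` is a contraction for the `L₂`-norm. -/
lemma eLpNorm_P_le (E : HypergroupExpectation G) {m : Measure G} [IsFiniteMeasureOnCompacts m]
    (hm : E.Preserves m) {h : G →ᵇ ℂ} (hh : HasCompactSupport h) :
    eLpNorm (E.P h) 2 m ≤ eLpNorm h 2 m := by
  have hPh := E.map_hasCompactSupport hh
  have hs : HasCompactSupport (star h * h : G →ᵇ ℂ) := by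
    rw [BoundedContinuousFunction.coe_mul]
    exact hh.mul_left
  have hPs := E.map_hasCompactSupport hs
  rw [(h.continuous.memLp_of_hasCompactSupport (p := 2) hh).eLpNorm_eq_integral_rpow_norm
      (by norm_num) (by norm_num),
    ((E.P h).continuous.memLp_of_hasCompactSupport (p := 2) hPh).eLpNorm_eq_integral_rpow_norm
      (by norm_num) (by norm_num)]
  refine ENNReal.ofReal_le_ofReal (Real.rpow_le_rpow (by positivity) ?_ (by simp))
  simp only [ENNReal.toReal_ofNat, Real.rpow_ofNat]
  have hi1 : Integrable (fun p => E.P (star h * h) p) m :=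
    (E.P (star h * h)).continuous.integrable_of_hasCompactSupport hPs
  have hi2 : Integrable (fun p => (star h * h : G →ᵇ ℂ) p) m :=
    (star h * h : G →ᵇ ℂ).continuous.integrable_of_hasCompactSupport hs
  have hi3 : Integrable (fun p => ‖E.P h p‖ ^ 2) m := by
    refine Continuous.integrable_of_hasCompactSupport (by fun_prop) ?_
    exact hPh.comp_left (g := fun z : ℂ => ‖z‖ ^ 2) (by simp)
  calc ∫ p, ‖E.P h p‖ ^ 2 ∂m ≤ ∫ p, (E.P (star h * h) p).re ∂m := by
        refine integral_mono hi3 hi1.re fun p => ?_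
        have := (Complex.le_def.1 (E.norm_sq_le h p)).1
        rwa [Complex.ofReal_re] at this
    _ = (∫ p, E.P (star h * h) p ∂m).re := integral_re hi1
    _ = (∫ p, (star h * h : G →ᵇ ℂ) p ∂m).re := by rw [hm _ hs]
    _ = ∫ p, ((star h * h : G →ᵇ ℂ) p).re ∂m := (integral_re hi2).symm
    _ = ∫ p, ‖h p‖ ^ 2 ∂m := by
        congr 1
        ext p
        have : (star h * h : G →ᵇ ℂ) p = ((‖h p‖ ^ 2 : ℝ) : ℂ) := by
          simp [Complex.conj_mul']
        rw [this, Complex.ofReal_re]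

lemma norm_incl (E : HypergroupExpectation G) (m : Measure G) [IsFiniteMeasureOnCompacts m]
    (f : E.𝒦) : ‖E.incl m f‖ = (eLpNorm (fun p => f.1 (E.φ p)) 2 m).toReal := by
  have hf : MemLp f.1 2 (E.mQ m) := f.1.continuous.memLp_of_hasCompactSupport (p := 2) f.2
  have h : ‖E.incl m f‖ = (eLpNorm f.1 2 (E.mQ m)).toReal := Lp.norm_toLp _ hf
  rw [h, mQ, eLpNorm_map_measure hf.1 E.continuous_φ.measurable.aemeasurable]
  rfl

/-- The estimate `‖λ_Q(ε_s) f‖₂ ≤ ‖f‖₂`. -/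
lemma norm_translate_le (E : HypergroupExpectation G) {m : Measure G} [m.IsHaarMeasure]
    (hm : E.Preserves m) (s : E.Q) (f : E.𝒦) :
    ‖E.incl m (E.translate s f)‖ ≤ 1 * ‖E.incl m f‖ := by
  obtain ⟨p, rfl⟩ := E.surjective_φ s
  rw [one_mul, norm_incl, norm_incl]
  have hf := E.lift_hasCompactSupport f
  have hPf := E.map_hasCompactSupport hf
  refine ENNReal.toReal_mono
    ((E.lift f.1).continuous.memLp_of_hasCompactSupport (p := 2) hf).2.ne ?_
  have h1 : (fun q => (E.translate (E.φ p) f).1 (E.φ q)) =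
      E.P (sliceRight (comul (E.P (E.lift f.1))) p⁻¹) := by
    ext q
    rw [translate_apply, inv_φ, comulQ_φ']
  rw [h1]
  calc eLpNorm (E.P (sliceRight (comul (E.P (E.lift f.1))) p⁻¹)) 2 m
      ≤ eLpNorm (sliceRight (comul (E.P (E.lift f.1))) p⁻¹) 2 m :=
        E.eLpNorm_P_le hm (hasCompactSupport_slice hPf _)
    _ = eLpNorm (E.P (E.lift f.1)) 2 m :=
        eLpNorm_comp_measurePreserving
          ((E.P (E.lift f.1)).continuous.memLp_of_hasCompactSupport (p := 2) hPf).1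
          (measurePreserving_mul_left m p⁻¹)
    _ ≤ eLpNorm (E.lift f.1) 2 m := E.eLpNorm_P_le hm hf

/-- The operator `λ_Q(ε_s)` on `L₂(Q)`: the extension by continuity of the left translation on the
dense subspace `𝒦(Q)`. -/
def translation (E : HypergroupExpectation G) (m : Measure G) [m.IsHaarMeasure] (s : E.Q) :
    E.L2 m →L[ℂ] E.L2 m :=
  ((E.incl m).comp (E.translate s)).extendOfNorm (E.incl m)

lemma translation_eq_zero (E : HypergroupExpectation G) {m : Measure G} [m.IsHaarMeasure]
    (h : ¬ DenseRange (E.incl m)) (s : E.Q) : E.translation m s = 0 := by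
  have h' : ¬ (DenseRange (LinearMap.range (E.incl m)).subtypeL ∧
      IsUniformInducing (LinearMap.range (E.incl m)).subtypeL) := by
    rintro ⟨h1, -⟩
    apply h
    have h2 : Set.range (LinearMap.range (E.incl m)).subtypeL = Set.range (E.incl m) := by
      ext x
      simp only [Set.mem_range, Submodule.coe_subtypeL, Submodule.coe_subtype]
      exact ⟨fun ⟨y, hy⟩ => hy ▸ y.2, fun hx => ⟨⟨x, hx⟩, rfl⟩⟩
    rw [DenseRange, h2] at h1
    exact h1
  rw [translation, LinearMap.extendOfNorm, ContinuousLinearMap.extend, dif_neg h']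

lemma continuous_inner_translate (E : HypergroupExpectation G) {m : Measure G} [m.IsHaarMeasure]
    (f g : E.𝒦) : Continuous fun s => ⟪E.incl m g, E.incl m (E.translate s f)⟫_ℂ := by
  have hg : HasCompactSupport g.1 := g.2
  have h1 : ∀ s, ⟪E.incl m g, E.incl m (E.translate s f)⟫_ℂ =
      ∫ t, E.comulQ f.1 (E.inv s, t) * star (g.1 t) ∂(E.mQ m) := by
    intro s
    rw [L2.inner_def]
    refine integral_congr_ae ?_
    have e1 : E.incl m g =ᵐ[E.mQ m] g.1 :=
      MemLp.coeFn_toLp (g.1.continuous.memLp_of_hasCompactSupport (p := 2) g.2)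
    have e2 : E.incl m (E.translate s f) =ᵐ[E.mQ m] (E.translate s f).1 :=
      MemLp.coeFn_toLp ((E.translate s f).1.continuous.memLp_of_hasCompactSupport (p := 2)
        (E.translate s f).2)
    filter_upwards [e1, e2] with t h1 h2
    rw [h1, h2]
    simp
  simp only [h1]
  rw [← continuousOn_univ]
  refine continuousOn_integral_of_compact_support hg.isCompact (Continuous.continuousOn ?_) ?_
  · have : Continuous E.inv := E.continuous_inv
    simp only [Function.uncurry_def]
    fun_prop
  · intro s t _ ht
    rw [image_eq_zero_of_notMem_tsupport (f := g.1) ht, star_zero, mul_zero]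

/-- The left regular representation `s ↦ λ_Q(ε_s)` of `Q` on `L₂(Q)`. -/
def translations (E : HypergroupExpectation G) (m : Measure G) [m.IsHaarMeasure]
    (hm : E.Preserves m) : ContractionFamily E.Q (E.L2 m) :=
  have hle : ∀ s, ‖E.translation m s‖ ≤ 1 := by
    intro s
    by_cases h : DenseRange (E.incl m)
    · exact LinearMap.opNorm_extendOfNorm_le h zero_le_one (E.norm_translate_le hm s)
    · rw [E.translation_eq_zero h, norm_zero]
      exact zero_le_one
  { op := E.translation m
    norm_op_le := hle
    continuous_inner := by
      by_cases h : DenseRange (E.incl m)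
      · refine continuous_inner_of_dense hle h ?_
        rintro _ ⟨g, rfl⟩ _ ⟨f, rfl⟩
        refine (E.continuous_inner_translate (m := m) f g).congr fun s => ?_
        rw [translation, LinearMap.extendOfNorm_eq h ⟨1, E.norm_translate_le hm s⟩]
        rfl
      · intro ξ η
        simp only [E.translation_eq_zero h]
        simpa using continuous_const }

/-- The left regular representation `λ_Q` of `M_b(Q)` on `L₂(Q)`: `λ_Q(μ) = ∫ λ_Q(ε_s) dμ(s)`. -/
def leftRegular (E : HypergroupExpectation G) (m : Measure G) [m.IsHaarMeasure]
    (hm : E.Preserves m) : Mb E.Q →ₗ[ℂ] (E.L2 m →L[ℂ] E.L2 m) :=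
  (E.translations m hm).integral

/-- The Hilbert space tensor product `L₂(Q) ⊗ L₂(Q)`. -/
abbrev L2Tensor (E : HypergroupExpectation G) (m : Measure G) : Type _ :=
  UniformSpace.Completion (E.L2 m ⊗[ℂ] E.L2 m)

/-- The representation `λ_Q ⊗ λ_Q` of `M_b(Q × Q)` on `L₂(Q) ⊗ L₂(Q)`:
`(λ_Q ⊗ λ_Q)(ν) = ∫ λ_Q(ε_s) ⊗ λ_Q(ε_t) dν(s, t)`. -/
def leftRegularTensor (E : HypergroupExpectation G) (m : Measure G) [m.IsHaarMeasure]
    (hm : E.Preserves m) : Mb (E.Q × E.Q) →ₗ[ℂ] (E.L2Tensor m →L[ℂ] E.L2Tensor m) :=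
  ((E.translations m hm).tensor (E.translations m hm)).integral

/-- `(λ_Q ⊗ λ_Q)(μ ⊗ ν) = λ_Q(μ) ⊗ λ_Q(ν)`. -/
lemma leftRegularTensor_tensor (E : HypergroupExpectation G) (m : Measure G) [m.IsHaarMeasure]
    (hm : E.Preserves m) (μ ν : Mb E.Q) : E.leftRegularTensor m hm (μ.tensor ν) =
      (TensorProduct.mapL (E.leftRegular m hm μ) (E.leftRegular m hm ν)).completion := by
  refine ContinuousLinearMap.ext fun η => ext_inner_left ℂ fun ξ => ?_
  have key : ∀ a b c d : E.L2 m, ⟪((a ⊗ₜ[ℂ] b : E.L2 m ⊗[ℂ] E.L2 m) : E.L2Tensor m),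
      E.leftRegularTensor m hm (μ.tensor ν) ((c ⊗ₜ[ℂ] d : E.L2 m ⊗[ℂ] E.L2 m) : E.L2Tensor m)⟫_ℂ =
      ⟪a, E.leftRegular m hm μ c⟫_ℂ * ⟪b, E.leftRegular m hm ν d⟫_ℂ := by
    intro a b c d
    rw [leftRegularTensor, ContractionFamily.inner_integral, leftRegular,
      ContractionFamily.inner_integral, ContractionFamily.inner_integral, Mb.tensor_apply]
    have h1 : ν.partialPairing (((E.translations m hm).tensor (E.translations m hm)).coeff
        (a ⊗ₜ[ℂ] b : E.L2 m ⊗[ℂ] E.L2 m) (c ⊗ₜ[ℂ] d : E.L2 m ⊗[ℂ] E.L2 m)) =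
        ν.1 ((E.translations m hm).coeff b d) • (E.translations m hm).coeff a c := by
      ext s
      have h2 : sliceRight (((E.translations m hm).tensor (E.translations m hm)).coeff
          (a ⊗ₜ[ℂ] b : E.L2 m ⊗[ℂ] E.L2 m) (c ⊗ₜ[ℂ] d : E.L2 m ⊗[ℂ] E.L2 m)) s =
          (E.translations m hm).coeff a c s • (E.translations m hm).coeff b d := by
        ext t
        change ⟪((a ⊗ₜ[ℂ] b : E.L2 m ⊗[ℂ] E.L2 m) : E.L2Tensor m),
          (TensorProduct.mapL ((E.translations m hm).op s) ((E.translations m hm).op t)).completion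
            ((c ⊗ₜ[ℂ] d : E.L2 m ⊗[ℂ] E.L2 m) : E.L2Tensor m)⟫_ℂ = _
        rw [ContinuousLinearMap.completion_apply_coe, UniformSpace.Completion.inner_coe,
          TensorProduct.mapL_tmul, TensorProduct.inner_tmul]
        rfl
      rw [Mb.partialPairing_apply, h2, map_smul]
      exact mul_comm _ _
    rw [h1, map_smul, smul_eq_mul, mul_comm]
  induction ξ using UniformSpace.Completion.induction_on with
  | hp => exact isClosed_eq (by fun_prop) (by fun_prop)
  | ih ξ =>
    induction η using UniformSpace.Completion.induction_on with
    | hp => exact isClosed_eq (by fun_prop) (by fun_prop)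
    | ih η =>
      induction ξ with
      | zero => rw [UniformSpace.Completion.coe_zero, inner_zero_left, inner_zero_left]
      | add x y hx hy => rw [UniformSpace.Completion.coe_add, inner_add_left, inner_add_left, hx, hy]
      | tmul a b =>
        induction η with
        | zero => rw [UniformSpace.Completion.coe_zero, map_zero, map_zero]
        | add x y hx hy =>
          rw [UniformSpace.Completion.coe_add, map_add, map_add, inner_add_right, inner_add_right,
            hx, hy]
        | tmul c d =>
          rw [key, ContinuousLinearMap.completion_apply_coe, UniformSpace.Completion.inner_coe,
            TensorProduct.mapL_tmul, TensorProduct.inner_tmul]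

/-- The space `L₁(m̃) = {f m̃ : f ∈ L₁(Q, m̃)}` of measures on `Q`. -/
def L1 (E : HypergroupExpectation G) (m : Measure G) : Submodule ℂ (Mb E.Q) where
  carrier := {μ | ∃ f : E.Q → ℂ, Integrable f (E.mQ m) ∧
    ∀ g : E.Q →ᵇ ℂ, μ.1 g = ∫ t, g t * f t ∂(E.mQ m)}
  zero_mem' := ⟨0, integrable_zero _ _ _, fun g => by simp⟩
  add_mem' := by
    rintro μ ν ⟨f, hf, h1⟩ ⟨f', hf', h2⟩
    refine ⟨f + f', hf.add hf', fun g => ?_⟩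
    have hb : ∀ {f : E.Q → ℂ}, Integrable f (E.mQ m) → Integrable (fun t => g t * f t) (E.mQ m) :=
      fun hf => hf.bdd_mul g.continuous.aestronglyMeasurable
        (Filter.Eventually.of_forall g.norm_coe_le_norm)
    simp only [Pi.add_apply, mul_add]
    rw [integral_add (hb hf) (hb hf'), ← h1, ← h2]
    rfl
  smul_mem' := by
    rintro c μ ⟨f, hf, h1⟩
    refine ⟨c • f, hf.smul c, fun g => ?_⟩
    have : (fun t => g t * (c • f) t) = fun t => c • (g t * f t) := by
      ext t
      simp only [Pi.smul_apply, smul_eq_mul]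
      ring
    rw [this, integral_smul, ← h1]
    rfl

end HypergroupExpectation

/-! ### Complete positivity -/

/-- A linear map `Φ` into a C*-algebra `A` is completely positive on a `*`-subalgebra `S` if, for all
`n`, the map `id ⊗ Φ` sends `M⋆ M` to a positive element of the C*-algebra `Mat_n(A)`, for all
matrices `M ∈ Mat_n(S)`. -/
def IsCompletelyPositiveOn {𝓑 A : Type*} [AddCommGroup 𝓑] [Module ℂ 𝓑] [Mul 𝓑] [Star 𝓑]
    [CStarAlgebra A] [PartialOrder A] [StarOrderedRing A] (Φ : 𝓑 →ₗ[ℂ] A)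
    (S : Submodule ℂ 𝓑) : Prop :=
  ∀ (n : ℕ) (M : CStarMatrix (Fin n) (Fin n) 𝓑), (∀ i j, M i j ∈ S) → 0 ≤ (star M * M).map Φ

end ExpectationHypergroup

end

/-! On a group the statement is immediate: `p ↦ λ(p) ⊗ λ(p)` is again a unitary representation, so
its integrated form is a `*`-representation of `L₁(G)`. On `Q` the map `s ↦ λ_Q(ε_s) ⊗ λ_Q(ε_s)` is
in general not multiplicative. The proof therefore realises it as a compression of the group
representation and multiplies in `G` before compressing.

Let `V : L₂(Q) → L₂(G)` be the isometry `f ↦ f ∘ φ`. Two properties of `P` carry the argument. It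
fixes every bounded continuous function that factors through `φ` (`map_lift`, by Stone–Weierstrass
on compact sets). It is also symmetric with respect to `m`: in an integral against `h ∘ φ`, a factor
`P g` may be replaced by `g` (`integral_map_mul`). Consequently `λ_Q(ε_{φ(p)}) = V⋆ λ(p) V`
(`inner_translation`). The same two properties remove both copies of `P` from the convolution of
`L₁(m̃)`: if `μ` and `ν` have densities `f` and `h`, then `⟨c, μ⋆ * ν⟩` is the double integral of
`c(φ(p⁻¹q))` against the conjugate of `f(φ(p))` and against `h(φ(q))` (`star_mul_apply`).

Apply this with `c(s) = ⟪x, (λ_Q(ε_s) ⊗ λ_Q(ε_s)) y⟫`. By the compression formula, `c(φ(p⁻¹q)) =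
⟪(λ(p) ⊗ λ(p)) x', (λ(q) ⊗ λ(q)) y'⟫` with `x' = (V ⊗ V) x` and `y' = (V ⊗ V) y`. Hence `⟪x, Φ(μ⋆ *
ν) y⟫ = ⟪T_f x, T_h y⟫`, where `T_f` is the integral of `f(φ(p)) (λ(p) ⊗ λ(p))` over `G`, composed
with `V ⊗ V` (`inner_leftRegularTensor_δ`).

The matrix obtained from `M⋆ M` is then a Gram matrix of operators, and such a matrix is positive
(`CStarMatrix.nonneg_of_gram`). -/

open scoped ComplexOrder InnerProductSpace

/-! ### Positivity of Gram matrices of operators -/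

/-- A self-adjoint element `x` of a C*-algebra is positive if no compression `y⋆ x y` of it is
negative and nonzero. -/
theorem IsSelfAdjoint.nonneg_of_forall_conjugate {A : Type*} [CStarAlgebra A] [PartialOrder A]
    [StarOrderedRing A] {x : A} (hx : IsSelfAdjoint x)
    (h : ∀ y v : A, star y * x * y = -(star v * v) → v = 0) : 0 ≤ x := by
  have hy0 : 0 ≤ x⁻ := CFC.negPart_nonneg x
  have hysa : star x⁻ = x⁻ := (IsSelfAdjoint.of_nonneg hy0).star_eq
  -- Compressing by `y = x⁻` gives `-(x⁻)³`. The factorisation `x⁻ = z⋆ z` turns this into `-(v⋆ v)`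
  -- with `v = z x⁻`, and `v = 0` forces `(x⁻)² = z⋆ v = 0`.
  obtain ⟨z, hz⟩ := CStarAlgebra.nonneg_iff_eq_star_mul_self.1 hy0
  have h1 : x * x⁻ = -(x⁻ * x⁻) := by
    calc x * x⁻ = (x⁺ - x⁻) * x⁻ := by rw [CFC.posPart_sub_negPart x hx]
      _ = _ := by rw [sub_mul, CFC.posPart_mul_negPart, zero_sub]
  have hv : z * x⁻ = 0 := by
    refine h x⁻ _ ?_
    calc star x⁻ * x * x⁻ = -(star x⁻ * x⁻ * x⁻) := by rw [mul_assoc, h1, mul_neg, mul_assoc]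
      _ = -(star x⁻ * (star z * z) * x⁻) := by rw [← hz]
      _ = _ := by rw [star_mul]; simp only [mul_assoc]
  have h3 : star x⁻ * x⁻ = 0 := by
    rw [hysa]
    nth_rewrite 1 [hz]
    rw [mul_assoc, hv, mul_zero]
  exact (CFC.negPart_eq_zero_iff x hx).1 ((CStarRing.star_mul_self_eq_zero_iff _).1 h3)

/-- A matrix `X` of operators such that `⟪x, X i j y⟫ = ∑ k, ⟪T k i x, T k j y⟫` is a positive
element of the C*-algebra of matrices over the bounded operators. -/
theorem CStarMatrix.nonneg_of_gram {ι n H K : Type*} [Fintype ι] [Fintype n]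
    [NormedAddCommGroup H] [InnerProductSpace ℂ H] [CompleteSpace H]
    [NormedAddCommGroup K] [InnerProductSpace ℂ K]
    (X : CStarMatrix n n (H →L[ℂ] H)) (T : ι → n → H →L[ℂ] K)
    (hX : ∀ i j x y, ⟪x, X i j y⟫_ℂ = ∑ k, ⟪T k i x, T k j y⟫_ℂ) : 0 ≤ X := by
  classical
  refine IsSelfAdjoint.nonneg_of_forall_conjugate ?_ fun Y V hmul => ?_
  · refine CStarMatrix.ext fun i j => ContinuousLinearMap.ext fun y => ext_inner_left ℂ fun x => ?_
    rw [CStarMatrix.star_apply, ContinuousLinearMap.star_eq_adjoint,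
      ContinuousLinearMap.adjoint_inner_right, ← inner_conj_symm, hX, hX, map_sum]
    simp only [inner_conj_symm]
  refine CStarMatrix.ext fun k j => ContinuousLinearMap.ext fun ξ => ?_
  -- Diagonal entries suffice: the `(j, j)` entry of `V⋆ V` contains the whole column `j` of `V`. At
  -- a vector `ξ`, the equation says that a sum of squared norms equals minus a sum of squared
  -- norms, so every term on the right vanishes.
  have e := congrArg (fun M : CStarMatrix n n (H →L[ℂ] H) => ⟪ξ, M j j ξ⟫_ℂ) hmul
  have e1 : ⟪ξ, (star Y * X * Y) j j ξ⟫_ℂ =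
      ((∑ k, ‖∑ i, T k i (Y i j ξ)‖ ^ 2 : ℝ) : ℂ) := by
    have : ∀ k, ((‖∑ i, T k i (Y i j ξ)‖ ^ 2 : ℝ) : ℂ) =
        ∑ i, ∑ l, ⟪T k i (Y i j ξ), T k l (Y l j ξ)⟫_ℂ := by
      intro k
      rw [Complex.ofReal_pow, ← Complex.coe_algebraMap, ← inner_self_eq_norm_sq_to_K (𝕜 := ℂ),
        sum_inner]
      simp only [inner_sum]
    rw [Complex.ofReal_sum]
    simp only [this]
    rw [mul_assoc, CStarMatrix.mul_apply, sum_apply, inner_sum,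
      Finset.sum_comm]
    refine Finset.sum_congr rfl fun i _ => ?_
    rw [Finset.sum_comm]
    change ⟪ξ, (star Y) j i ((X * Y) i j ξ)⟫_ℂ = _
    rw [CStarMatrix.star_apply, ContinuousLinearMap.star_eq_adjoint,
      ContinuousLinearMap.adjoint_inner_right,
      CStarMatrix.mul_apply, sum_apply, inner_sum]
    exact Finset.sum_congr rfl fun l _ => hX _ _ _ _
  have e2 : ⟪ξ, (-(star V * V)) j j ξ⟫_ℂ = ((-∑ k, ‖V k j ξ‖ ^ 2 : ℝ) : ℂ) := by
    change ⟪ξ, -((star V * V) j j ξ)⟫_ℂ = _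
    rw [Complex.ofReal_neg, Complex.ofReal_sum, inner_neg_right, CStarMatrix.mul_apply,
      sum_apply, inner_sum]
    congr 1
    refine Finset.sum_congr rfl fun l _ => ?_
    change ⟪ξ, (star V) j l (V l j ξ)⟫_ℂ = _
    rw [CStarMatrix.star_apply, ContinuousLinearMap.star_eq_adjoint,
      ContinuousLinearMap.adjoint_inner_right,
      inner_self_eq_norm_sq_to_K (𝕜 := ℂ)]
    simp
  simp only [e1, e2] at e
  have e3 : ∑ k, ‖∑ i, T k i (Y i j ξ)‖ ^ 2 = -∑ k, ‖V k j ξ‖ ^ 2 := by exact_mod_cast e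
  have e4 : 0 ≤ ∑ k, ‖∑ i, T k i (Y i j ξ)‖ ^ 2 := by positivity
  have e5 : ‖V k j ξ‖ ^ 2 ≤ ∑ k, ‖V k j ξ‖ ^ 2 :=
    Finset.single_le_sum (f := fun k => ‖V k j ξ‖ ^ 2) (fun _ _ => by positivity)
      (Finset.mem_univ k)
  have e6 : ‖V k j ξ‖ ^ 2 = 0 := le_antisymm (by linarith) (by positivity)
  simpa using e6

/-! ### The expectation as a module map fixing the functions on `Q` -/

namespace ExpectationHypergroup
open scoped BoundedContinuousFunction ZeroAtInfty ComplexOrder InnerProductSpace TensorProduct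
  Topology

namespace ProperExpectation

variable {G : Type*} [TopologicalSpace G]

/-- `P` is a module map over its range. -/
lemma map_mul [LocallyCompactSpace G] [T2Space G] (E : ProperExpectation G) {b : G →ᵇ ℂ}
    (hb : E.P b = b) (f : G →ᵇ ℂ) :
    E.P (b * f) = b * E.P f := by
  ext x
  obtain ⟨k, hk, hk0, hk1⟩ := exists_bump (isCompact_singleton (x := x))
  have hpos : E.P k x ≠ 0 := (E.map_pos k hk hk0 x (by rw [hk1 x rfl]; exact one_pos)).ne'
  -- The bimodule identity needs a fixed factor on both sides, and `1` is not yet known to be fixed.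
  -- Multiplying by `(P k)²`, which is nonzero at `x`, supplies both factors: `P k * b` on the left
  -- and `P k` on the right.
  have hkb : E.P (E.P k * b) = E.P k * b :=
    E.isCondExp.range_mul _ _ (E.isCondExp.idem k) hb
  have h1 := E.mul_apply (b * f) k x
  have h2 := E.isCondExp.bimodule _ f _ hkb (E.isCondExp.idem k)
  rw [← mul_assoc (E.P k) b f, h2] at h1
  simp only [BoundedContinuousFunction.coe_mul, Pi.mul_apply] at h1 ⊢
  refine mul_right_cancel₀ (mul_ne_zero hpos hpos) ?_
  rw [h1]
  ring

-- Unitality is not an axiom; it follows from `P k = P (P k · 1) = P k · P 1`, where `P k` can be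
-- made nonzero at any given point. It puts the constants into `fixedOn`, as Stone–Weierstrass
-- requires.
@[simp] lemma map_one [LocallyCompactSpace G] [T2Space G] (E : ProperExpectation G) :
    E.P 1 = 1 := by
  ext x
  obtain ⟨k, hk, hk0, hk1⟩ := exists_bump (isCompact_singleton (x := x))
  have hpos : E.P k x ≠ 0 := (E.map_pos k hk hk0 x (by rw [hk1 x rfl]; exact one_pos)).ne'
  have h := DFunLike.congr_fun (E.map_mul (E.isCondExp.idem k) 1) x
  rw [mul_one, E.isCondExp.idem] at h
  exact mul_left_cancel₀ hpos (by simpa using h.symm)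

/-- If `f` is bounded by `ε` on a set `L` controlling the values of `P` on `K`, then `P f` is bounded
by `ε` on `K`. -/
lemma norm_map_apply_le (E : ProperExpectation G) {K L : Set G}
    (hL : ∀ f : G →ᵇ ℂ, (∀ x ∈ L, f x = 0) → ∀ x ∈ K, E.P f x = 0) {f : G →ᵇ ℂ} {ε : ℝ}
    (hε : 0 < ε) (hf : ∀ x ∈ L, ‖f x‖ ≤ ε) {x : G} (hx : x ∈ K) : ‖E.P f x‖ ≤ ε := by
  have hpos : ∀ x, 0 < max ε ‖f x‖ := fun x => lt_max_of_lt_left hε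
  have hbd : ∀ x, ‖f x * ((ε / max ε ‖f x‖ : ℝ) : ℂ)‖ ≤ ε := by
    intro x
    rw [norm_mul, Complex.norm_real, Real.norm_of_nonneg (by have := hpos x; positivity),
      mul_div_assoc', div_le_iff₀ (hpos x), mul_comm]
    exact mul_le_mul_of_nonneg_left (le_max_right _ _) hε.le
  -- The radial truncation of `f` to the disc of radius `ε`: it agrees with `f` on `L`, hence `P g =
  -- P f` on `K`, and its norm is at most `ε` everywhere, so the contractivity of `P` applies.
  let g : G →ᵇ ℂ := BoundedContinuousFunction.ofNormedAddCommGroup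
    (fun x => f x * ((ε / max ε ‖f x‖ : ℝ) : ℂ))
    (f.continuous.mul (Complex.continuous_ofReal.comp
      (continuous_const.div (by fun_prop) fun x => (hpos x).ne'))) ε hbd
  have h0 : E.P (f - g) x = 0 := by
    refine hL _ (fun y hy => ?_) x hx
    change f y - f y * ((ε / max ε ‖f y‖ : ℝ) : ℂ) = 0
    rw [max_eq_left (hf y hy), div_self hε.ne']
    simp
  have h1 : E.P f x = E.P g x := by
    rw [map_sub] at h0
    exact sub_eq_zero.1 h0
  rw [h1]
  exact ((E.P g).norm_coe_le_norm x).trans ((E.norm_apply_le g).trans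
    (BoundedContinuousFunction.norm_ofNormedAddCommGroup_le _ hε.le hbd))

end ProperExpectation

namespace HypergroupExpectation

variable {G : Type*} [TopologicalSpace G] [Group G] [IsTopologicalGroup G]
  [LocallyCompactSpace G] [T2Space G]

/-- The Gelfand transform of an element of `B`. -/
noncomputable def gelfand (E : HypergroupExpectation G) (b : E.B) : E.Q →ᵇ ℂ :=
  BoundedContinuousFunction.ofNormedAddCommGroup (fun s => s b) (E.continuous_apply b)
    ‖(b : C₀(G, ℂ))‖ fun s => by
      obtain ⟨p, rfl⟩ := E.surjective_φ s
      exact b.1.toBCF.norm_coe_le_norm p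

lemma lift_gelfand (E : HypergroupExpectation G) (b : E.B) : E.lift (E.gelfand b) = b.1.toBCF := rfl

lemma map_toBCF (E : HypergroupExpectation G) (b : E.B) : E.P b.1.toBCF = b.1.toBCF := by
  obtain ⟨f, hf⟩ := b.2
  rw [← hf, E.isCondExp.idem]

/-- The functions on `Q` which are fixed by `P`, restricted to `K`. -/
def fixedOn (E : HypergroupExpectation G) (K : Set E.Q) : StarSubalgebra ℂ C(K, ℂ) where
  carrier := {h | ∃ g : E.Q →ᵇ ℂ, E.P (E.lift g) = E.lift g ∧ ∀ s : K, h s = g s}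
  mul_mem' := by
    rintro _ _ ⟨g, hg, h1⟩ ⟨g', hg', h2⟩
    exact ⟨g * g', E.isCondExp.range_mul _ _ hg hg', fun s => by simp [h1, h2]⟩
  add_mem' := by
    rintro _ _ ⟨g, hg, h1⟩ ⟨g', hg', h2⟩
    refine ⟨g + g', ?_, fun s => by simp [h1, h2]⟩
    have : E.lift (g + g') = E.lift g + E.lift g' := rfl
    rw [this, map_add, hg, hg']
  algebraMap_mem' c := by
    refine ⟨c • 1, ?_, fun s => by simp⟩
    have : E.lift (c • 1) = c • 1 := rfl
    rw [this, map_smul, E.map_one]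
  star_mem' := by
    rintro _ ⟨g, hg, h1⟩
    refine ⟨star g, ?_, fun s => by simp [h1]⟩
    have : E.lift (star g) = star (E.lift g) := rfl
    rw [this, E.map_star, hg]

/-- Distinct characters differ on some `b` in `B`, and the Gelfand transform of `b` lifts to `b`
itself, which lies in the range of `P`. -/
lemma separatesPoints_fixedOn (E : HypergroupExpectation G) (K : Set E.Q) :
    (E.fixedOn K).SeparatesPoints := by
  intro s t hst
  have : ∃ b : E.B, s.1 b ≠ t.1 b := by
    by_contra! h
    exact hst (Subtype.ext (DFunLike.coe_injective (funext h)))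
  obtain ⟨b, hb⟩ := this
  exact ⟨_, ⟨(E.gelfand b).toContinuousMap.restrict K,
    ⟨E.gelfand b, by rw [lift_gelfand, map_toBCF], fun _ => rfl⟩, rfl⟩, hb⟩

/-- `P` fixes the functions on `Q`. -/
lemma map_lift (E : HypergroupExpectation G) (f : E.Q →ᵇ ℂ) : E.P (E.lift f) = E.lift f := by
  ext p
  obtain ⟨L, hL, hLP⟩ := E.exists_compact_control (isCompact_singleton (x := p))
  -- The approximation by a fixed function `g` is needed in two places: on `φ(L)`, to control `P (f
  -- - g)` at `p`, and at `φ(p)`, to compare `g` with `f` there. Uniform approximation on all of `Q`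
  -- is not available, since `f` is only bounded and continuous.
  have hK : IsCompact (insert (E.φ p) (E.φ '' L)) := (hL.image E.continuous_φ).insert _
  set K : Set E.Q := insert (E.φ p) (E.φ '' L)
  have : CompactSpace K := isCompact_iff_compactSpace.1 hK
  have hmem : f.toContinuousMap.restrict K ∈ (E.fixedOn K).topologicalClosure := by
    rw [ContinuousMap.starSubalgebra_topologicalClosure_eq_top_of_separatesPoints _
      (E.separatesPoints_fixedOn K)]
    trivial
  refine eq_of_forall_dist_le fun ε hε => ?_
  obtain ⟨h, ⟨g, hg, hgh⟩, hd⟩ := Metric.mem_closure_iff.1 hmem (ε / 2) (half_pos hε)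
  have hfg : ∀ s ∈ K, ‖f s - g s‖ ≤ ε / 2 := by
    intro s hs
    have h1 := (ContinuousMap.dist_apply_le_dist (f := f.toContinuousMap.restrict K) (g := h)
      ⟨s, hs⟩).trans hd.le
    rw [hgh, dist_eq_norm] at h1
    exact h1
  have h2 : ‖E.P (E.lift f - E.lift g) p‖ ≤ ε / 2 :=
    E.norm_map_apply_le hLP (half_pos hε)
      (fun x hx => hfg _ (Set.mem_insert_of_mem _ ⟨x, hx, rfl⟩)) rfl
  have h3 : ‖f (E.φ p) - g (E.φ p)‖ ≤ ε / 2 := hfg _ (Set.mem_insert _ _)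
  rw [map_sub, hg] at h2
  rw [dist_eq_norm]
  calc ‖E.P (E.lift f) p - E.lift f p‖
      = ‖(E.P (E.lift f) - E.lift g) p - (f (E.φ p) - g (E.φ p))‖ := by
        congr 1
        change _ = (E.P (E.lift f) p - g (E.φ p)) - (f (E.φ p) - g (E.φ p))
        rw [sub_sub_sub_cancel_right]
        rfl
    _ ≤ ε / 2 + ε / 2 := (norm_sub_le _ _).trans (add_le_add h2 h3)
    _ = ε := add_halves ε

end HypergroupExpectation
end ExpectationHypergroup

/-! ### Regular measures: proper images and density of `𝒦` in `L^p` -/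

/-- The image of a regular measure under a proper map is regular. -/
theorem MeasureTheory.Measure.Regular.map_of_isProperMap {X Y : Type*} [TopologicalSpace X]
    [TopologicalSpace Y] [T2Space Y] [MeasurableSpace X] [BorelSpace X] [MeasurableSpace Y]
    [BorelSpace Y] {μ : MeasureTheory.Measure X} [μ.Regular] {f : X → Y} (hf : IsProperMap f) :
    (μ.map f).Regular where
  lt_top_of_isCompact K hK := by
    rw [MeasureTheory.Measure.map_apply hf.continuous.measurable hK.measurableSet]
    exact (hf.isCompact_preimage hK).measure_lt_top
  outerRegular A hA r hr := by
    rw [MeasureTheory.Measure.map_apply hf.continuous.measurable hA] at hr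
    obtain ⟨U, hAU, hU, hUr⟩ := Set.exists_isOpen_lt_of_lt _ r hr
    -- The points whose whole fibre lies in `U` form the largest set with preimage inside `U`; it is
    -- open because a proper map is closed.
    have hV : IsOpen (f '' Uᶜ)ᶜ := (hf.isClosedMap _ hU.isClosed_compl).isOpen_compl
    refine ⟨(f '' Uᶜ)ᶜ, ?_, hV, ?_⟩
    · rintro _ hy ⟨x, hx, rfl⟩
      exact hx (hAU hy)
    · rw [MeasureTheory.Measure.map_apply hf.continuous.measurable hV.measurableSet]
      refine (MeasureTheory.measure_mono fun x hx => ?_).trans_lt hUr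
      by_contra h
      exact hx ⟨x, h, rfl⟩
  innerRegular := MeasureTheory.Measure.Regular.innerRegular.map
    hf.continuous.measurable.aemeasurable (fun _ hU => hU.preimage hf.continuous)
    (fun _ hK => hK.image hf.continuous) (fun _ hU => hU.measurableSet)

open MeasureTheory in
/-- In a locally compact Hausdorff space with a regular measure, the continuous functions with compact
support are dense in `L^p` for `p < ∞`. No normality of the space is needed. -/
theorem MeasureTheory.MemLp.exists_continuous_hasCompactSupport_eLpNorm_sub_le {X : Type*}
    [TopologicalSpace X] [T2Space X] [LocallyCompactSpace X] [MeasurableSpace X] [BorelSpace X]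
    {E : Type*} [NormedAddCommGroup E] [NormedSpace ℝ E] {μ : Measure X} [μ.Regular] {p : ENNReal}
    (hp : p ≠ ⊤) {f : X → E} (hf : MemLp f p μ) {ε : ENNReal} (hε : ε ≠ 0) :
    ∃ g : X → E, eLpNorm (f - g) p μ ≤ ε ∧ Continuous g ∧ MemLp g p μ ∧ HasCompactSupport g := by
  refine hf.induction_dense hp
    (fun g : X → E => Continuous g ∧ MemLp g p μ ∧ HasCompactSupport g) ?_ ?_ ?_ hε
  · intro c t ht htμ ε hε
    -- Halving through `exists_Lp_half` instead of `ε / 2` covers `p < 1` as well, where the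
    -- triangle inequality fails.
    obtain ⟨δ, hδ, hδε⟩ := exists_Lp_half E μ p hε
    obtain ⟨η, hη, hηδ⟩ :
        ∃ η : NNReal, 0 < η ∧ ∀ s : Set X, μ s ≤ η → eLpNorm (s.indicator fun _ => c) p μ ≤ δ :=
      exists_eLpNorm_indicator_le hp c hδ.ne'
    have hη' : (0 : ENNReal) < η := ENNReal.coe_pos.2 hη
    -- The set `t` is first replaced by a compact subset `s` and then enclosed in an open `V ⊇ s`,
    -- each at a cost below `η` in measure. Separating a compact set from a closed set by a
    -- continuous function requires only local compactness.
    obtain ⟨s, hst, hs, hsc, hsμ⟩ := ht.exists_isCompact_isClosed_sdiff_lt htμ.ne hη'.ne'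
    obtain ⟨V, hsV, hV, -, hVμ⟩ := hsc.measurableSet.exists_isOpen_sdiff_lt
      ((measure_mono hst).trans_lt htμ).ne hη'.ne'
    obtain ⟨k, hk1, hk0, hkc, hk⟩ := exists_continuous_one_zero_of_isCompact hs
      hV.isClosed_compl (Set.disjoint_compl_right_iff_subset.2 hsV)
    have hgc : Continuous fun x => k x • c := by fun_prop
    have hgs : HasCompactSupport fun x => k x • c := hkc.smul_right
    have hgm : MemLp (fun x => k x • c) p μ := hgc.memLp_of_hasCompactSupport hgs
    refine ⟨fun x => k x • c, ?_, hgc, hgm, hgs⟩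
    have I1 : eLpNorm ((s.indicator fun _ => c) - t.indicator fun _ => c) p μ ≤ δ := by
      rw [← eLpNorm_neg, neg_sub, ← Set.indicator_sdiff hst]
      exact hηδ _ hsμ.le
    have I2 : eLpNorm ((fun x => k x • c) - s.indicator fun _ => c) p μ ≤ δ := by
      refine (eLpNorm_mono fun x => ?_).trans (hηδ _ hVμ.le)
      by_cases hxs : x ∈ s
      · have : k x = 1 := hk1 hxs
        simp [hxs, this]
      by_cases hxV : x ∈ V
      · have h1 : x ∈ V \ s := ⟨hxV, hxs⟩
        rw [Pi.sub_apply, Set.indicator_of_notMem hxs, Set.indicator_of_mem h1, sub_zero, norm_smul,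
          Real.norm_of_nonneg (hk x).1]
        exact mul_le_of_le_one_left (norm_nonneg _) (hk x).2
      · have : k x = 0 := hk0 hxV
        simp [hxs, this]
    have hsm := (aestronglyMeasurable_const (μ := μ) (b := c)).indicator hsc.measurableSet
    have htm := (aestronglyMeasurable_const (μ := μ) (b := c)).indicator ht
    have := (hδε _ _ (hgm.aestronglyMeasurable.sub hsm) (hsm.sub htm) I2 I1).le
    rwa [sub_add_sub_cancel] at this
  · rintro f g ⟨hf, hfm, hfs⟩ ⟨hg, hgm, hgs⟩
    exact ⟨hf.add hg, hfm.add hgm, hfs.add hgs⟩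
  · rintro f ⟨-, hf, -⟩
    exact hf.aestronglyMeasurable

open MeasureTheory in
theorem MeasureTheory.Integrable.exists_continuous_hasCompactSupport_integral_sub_le {X : Type*}
    [TopologicalSpace X] [T2Space X] [LocallyCompactSpace X] [MeasurableSpace X] [BorelSpace X]
    {E : Type*} [NormedAddCommGroup E] [NormedSpace ℝ E] {μ : Measure X} [μ.Regular]
    {f : X → E} (hf : Integrable f μ) {ε : ℝ} (hε : 0 < ε) :
    ∃ g : X → E, ∫ x, ‖f x - g x‖ ∂μ ≤ ε ∧ Continuous g ∧ Integrable g μ ∧ HasCompactSupport g := by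
  obtain ⟨g, h1, hg, hgi, hgs⟩ :=
    (memLp_one_iff_integrable.2 hf).exists_continuous_hasCompactSupport_eLpNorm_sub_le
      ENNReal.one_ne_top (ENNReal.ofReal_pos.2 hε).ne'
  rw [memLp_one_iff_integrable] at hgi
  refine ⟨g, ?_, hg, hgi, hgs⟩
  rw [eLpNorm_one_eq_lintegral_enorm] at h1
  change ∫ x, ‖(f - g) x‖ ∂μ ≤ ε
  rw [integral_norm_eq_lintegral_enorm (hf.sub hgi).aestronglyMeasurable]
  exact ENNReal.toReal_le_of_le_ofReal hε.le h1

/-! ### `Q` as a locally compact measure space, and symmetry of `P` -/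

namespace ExpectationHypergroup
open scoped BoundedContinuousFunction ZeroAtInfty ComplexOrder InnerProductSpace TensorProduct
  Topology

namespace HypergroupExpectation
open MeasureTheory

variable {G : Type*} [TopologicalSpace G] [Group G] [IsTopologicalGroup G]
  [LocallyCompactSpace G] [T2Space G]

/-- Since `φ` is onto, the superlevel set of `|b|` in `Q` is the image of the one in `G`, which is
compact because `b` vanishes at infinity. -/
instance (E : HypergroupExpectation G) : WeaklyLocallyCompactSpace E.Q where
  exists_compact_mem_nhds s := by
    obtain ⟨b, hb⟩ := E.exists_ne_zero s
    have hc : Continuous fun t : E.Q => ‖t b‖ := (E.continuous_apply b).norm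
    have himg : {t : E.Q | ‖s b‖ / 2 ≤ ‖t b‖} = E.φ '' {p | ‖s b‖ / 2 ≤ ‖b.1 p‖} := by
      ext t
      constructor
      · intro ht
        obtain ⟨p, rfl⟩ := E.surjective_φ t
        exact ⟨p, ht, rfl⟩
      · rintro ⟨p, hp, rfl⟩
        exact hp
    refine ⟨{t | ‖s b‖ / 2 ≤ ‖t b‖}, ?_, ?_⟩
    · rw [himg]
      exact (E.isCompact_ge b (half_pos (norm_pos_iff.2 hb))).image E.continuous_φ
    · filter_upwards [hc.continuousAt.eventually (lt_mem_nhds (half_lt_self (norm_pos_iff.2 hb)))]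
        with t ht using ht.le


lemma exists_𝒦 (E : HypergroupExpectation G) {g : E.Q → ℂ} (hg : Continuous g)
    (hs : HasCompactSupport g) : ∃ k : E.𝒦, ⇑k.1 = g := by
  obtain ⟨C, hC⟩ := hg.bounded_above_of_compact_support hs
  exact ⟨⟨BoundedContinuousFunction.ofNormedAddCommGroup g hg C hC, hs⟩, rfl⟩

variable [MeasurableSpace G]

instance [BorelSpace G] (E : HypergroupExpectation G) (m : Measure G) [m.Regular] :
    (E.mQ m).Regular :=
  Measure.Regular.map_of_isProperMap E.isProperMap_φ

lemma measurePreserving_φ [BorelSpace G] (E : HypergroupExpectation G) (m : Measure G) :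
    MeasurePreserving E.φ m (E.mQ m) := ⟨E.continuous_φ.measurable, rfl⟩

lemma integral_mQ [BorelSpace G] (E : HypergroupExpectation G) (m : Measure G) {f : E.Q → ℂ}
    (hf : AEStronglyMeasurable f (E.mQ m)) : ∫ t, f t ∂(E.mQ m) = ∫ p, f (E.φ p) ∂m :=
  integral_map E.continuous_φ.measurable.aemeasurable hf

/-- Without density, `extendOfNorm` takes the default value `0`. Together with the norm estimate for
`translate`, this lemma makes `translation` the genuine extension of the left translation on `𝒦(Q)`.
-/
lemma denseRange_incl [BorelSpace G] (E : HypergroupExpectation G) (m : Measure G) [m.Regular] :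
    DenseRange (E.incl m) := by
  intro f
  rw [EMetric.mem_closure_iff]
  intro ε hε
  obtain ⟨δ, hδ, hδε⟩ := exists_between hε
  obtain ⟨g, hg, hgc, hgm, hgs⟩ :=
    (Lp.memLp f).exists_continuous_hasCompactSupport_eLpNorm_sub_le (by norm_num) hδ.ne'
  obtain ⟨k, rfl⟩ := E.exists_𝒦 hgc hgs
  refine ⟨_, ⟨k, rfl⟩, lt_of_le_of_lt ?_ hδε⟩
  rw [Lp.edist_def]
  refine le_trans (le_of_eq (eLpNorm_congr_ae ?_)) hg
  exact Filter.EventuallyEq.rfl.sub (MemLp.coeFn_toLp hgm)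

/-- `P` is symmetric for the pairing given by `m`. -/
lemma integral_map_mul_lift (E : HypergroupExpectation G) {m : Measure G}
    [IsFiniteMeasureOnCompacts m] (hm : E.Preserves m) (g : G →ᵇ ℂ) (k : E.𝒦) :
    ∫ p, E.P g p * k.1 (E.φ p) ∂m = ∫ p, g p * k.1 (E.φ p) ∂m := by
  have hs : HasCompactSupport (E.lift k.1 * g : G →ᵇ ℂ) := by
    rw [BoundedContinuousFunction.coe_mul]
    exact (E.lift_hasCompactSupport k).mul_right
  -- Invariance of `m` is applied to the compactly supported product `(k ∘ φ) g`; as `k ∘ φ` is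
  -- fixed by `P`, it can be pulled out of `P`.
  have h := hm _ hs
  rw [E.map_mul (E.map_lift k.1)] at h
  simp only [mul_comm (E.P g _), mul_comm (g _)]
  exact h

/-- Matrix coefficients are bounded but need not have compact support, so the decay must come from
an integrable `h`. The difference of the two sides is the functional `h ↦ ∫ (P g - g) (h ∘ φ)`,
which vanishes on `𝒦(Q)` and is bounded by `‖P g - g‖` times the `L₁`-norm; density concludes. -/
lemma integral_map_mul [BorelSpace G] (E : HypergroupExpectation G) {m : Measure G} [m.Regular]
    (hm : E.Preserves m) (g : G →ᵇ ℂ) {h : E.Q → ℂ} (hh : Integrable h (E.mQ m)) :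
    ∫ p, E.P g p * h (E.φ p) ∂m = ∫ p, g p * h (E.φ p) ∂m := by
  have hφ := E.measurePreserving_φ m
  have hhφ : Integrable (fun p => h (E.φ p)) m := hφ.integrable_comp_of_integrable hh
  have hmul : ∀ (g : G →ᵇ ℂ) {f : G → ℂ}, Integrable f m → Integrable (fun p => g p * f p) m :=
    fun g f hf => hf.bdd_mul g.continuous.aestronglyMeasurable
      (Filter.Eventually.of_forall g.norm_coe_le_norm)
  refine eq_of_forall_dist_le fun ε hε => ?_
  -- The summand `1` only ensures that `ε / C` makes sense when `P g = g`.
  set C := ‖E.P g - g‖ + 1 with hC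
  have hC0 : 0 < C := by positivity
  obtain ⟨k, hk, hkc, hki, hks⟩ :=
    hh.exists_continuous_hasCompactSupport_integral_sub_le (show 0 < ε / C by positivity)
  obtain ⟨k, rfl⟩ := E.exists_𝒦 hkc hks
  have hkφ : Integrable (fun p => k.1 (E.φ p)) m := hφ.integrable_comp_of_integrable hki
  have hk' : ∫ p, ‖h (E.φ p) - k.1 (E.φ p)‖ ∂m ≤ ε / C := by
    refine le_trans (le_of_eq ?_) hk
    exact (integral_map E.continuous_φ.measurable.aemeasurable
      (hh.sub hki).norm.aestronglyMeasurable).symm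
  have e : ∫ p, E.P g p * h (E.φ p) ∂m - ∫ p, g p * h (E.φ p) ∂m =
      ∫ p, (E.P g - g) p * (h (E.φ p) - k.1 (E.φ p)) ∂m := by
    have h1 : ∀ p, (E.P g - g) p * (h (E.φ p) - k.1 (E.φ p)) =
        (E.P g p * h (E.φ p) - g p * h (E.φ p)) -
          (E.P g p * k.1 (E.φ p) - g p * k.1 (E.φ p)) := by
      intro p
      rw [BoundedContinuousFunction.coe_sub, Pi.sub_apply]
      ring
    have hsub : ∀ {f : G → ℂ}, Integrable f m → Integrable (fun p => E.P g p * f p - g p * f p) m :=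
      fun hf => (hmul _ hf).sub (hmul _ hf)
    simp only [h1]
    rw [integral_sub (hsub hhφ) (hsub hkφ),
      integral_sub (hmul _ hhφ) (hmul _ hhφ), integral_sub (hmul _ hkφ) (hmul _ hkφ),
      E.integral_map_mul_lift hm g k, sub_self, sub_zero]
  rw [dist_eq_norm, e]
  calc ‖∫ p, (E.P g - g) p * (h (E.φ p) - k.1 (E.φ p)) ∂m‖
      ≤ ∫ p, C * ‖h (E.φ p) - k.1 (E.φ p)‖ ∂m := by
        refine norm_integral_le_of_norm_le ((hhφ.sub hkφ).norm.const_mul C)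
          (Filter.Eventually.of_forall fun p => ?_)
        rw [norm_mul]
        gcongr
        linarith [(E.P g - g).norm_coe_le_norm p]
    _ = C * ∫ p, ‖h (E.φ p) - k.1 (E.φ p)‖ ∂m := integral_const_mul _ _
    _ ≤ C * (ε / C) := by gcongr
    _ = ε := by field_simp

end HypergroupExpectation
end ExpectationHypergroup

namespace ExpectationHypergroup
open scoped BoundedContinuousFunction ZeroAtInfty ComplexOrder InnerProductSpace TensorProduct
  Topology
open MeasureTheory

/-! ### Radon measures with integrable density -/

lemma integrable_bcf_mul {X : Type*} [TopologicalSpace X] [MeasurableSpace X]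
    [OpensMeasurableSpace X] {μ : Measure X} (g : X →ᵇ ℂ) {f : X → ℂ} (hf : Integrable f μ) :
    Integrable (fun x => g x * f x) μ :=
  hf.bdd_mul g.continuous.aestronglyMeasurable (Filter.Eventually.of_forall g.norm_coe_le_norm)

lemma norm_integral_bcf_mul_le {X : Type*} [TopologicalSpace X] [MeasurableSpace X]
    {μ : Measure X} (g : X →ᵇ ℂ) {f : X → ℂ} (hf : Integrable f μ) :
    ‖∫ x, g x * f x ∂μ‖ ≤ (∫ x, ‖f x‖ ∂μ) * ‖g‖ := by
  rw [mul_comm, ← integral_const_mul]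
  refine norm_integral_le_of_norm_le (hf.norm.const_mul _) (Filter.Eventually.of_forall fun x => ?_)
  rw [norm_mul]
  gcongr
  exact g.norm_coe_le_norm x

/-- The bounded Radon measure `f μ`, for a regular measure `μ` and `f ∈ L₁(μ)`. -/
noncomputable def Mb.ofIntegrable {X : Type*} [TopologicalSpace X] [T2Space X]
    [LocallyCompactSpace X] [MeasurableSpace X] [BorelSpace X] (μ : Measure X) [μ.Regular]
    {f : X → ℂ} (hf : Integrable f μ) : Mb X :=
  ⟨LinearMap.mkContinuous
    { toFun := fun g => ∫ x, g x * f x ∂μ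
      map_add' := fun g h => by
        rw [← integral_add (integrable_bcf_mul g hf) (integrable_bcf_mul h hf)]
        simp only [BoundedContinuousFunction.coe_add, Pi.add_apply, add_mul]
      map_smul' := fun c g => by
        rw [RingHom.id_apply, ← integral_smul]
        simp only [BoundedContinuousFunction.coe_smul, smul_mul_assoc] }
    (∫ x, ‖f x‖ ∂μ) (fun g => norm_integral_bcf_mul_le g hf), by
    intro ε hε
    obtain ⟨k, hk, -, hki, hks⟩ := hf.exists_continuous_hasCompactSupport_integral_sub_le hε
    refine ⟨tsupport k, hks, fun g hg => ?_⟩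
    -- For `g` vanishing on the support of `k`, only the `L₁`-small remainder `f - k` contributes;
    -- this gives tightness.
    have h : ∀ x, g x * f x = g x * (f x - k x) := by
      intro x
      by_cases hx : x ∈ tsupport k
      · rw [hg x hx, zero_mul, zero_mul]
      · rw [image_eq_zero_of_notMem_tsupport hx, sub_zero]
    change ‖∫ x, g x * f x ∂μ‖ ≤ _
    simp only [h]
    refine (norm_integral_bcf_mul_le g (hf.sub hki)).trans ?_
    gcongr
    exact hk⟩

/-- The composition of a family of contractions with a continuous map. -/
def ContractionFamily.comap {X Y H : Type*} [TopologicalSpace X] [TopologicalSpace Y]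
    [NormedAddCommGroup H] [InnerProductSpace ℂ H] (U : ContractionFamily X H) (f : C(Y, X)) :
    ContractionFamily Y H where
  op y := U.op (f y)
  norm_op_le y := U.norm_op_le (f y)
  continuous_inner ξ η := (U.continuous_inner ξ η).comp f.continuous

/-! ### Tensor squares of operators -/

/-- The operator `T ⊗ T` between Hilbert space tensor squares. -/
noncomputable def tensorSq {H K : Type*} [NormedAddCommGroup H] [InnerProductSpace ℂ H]
    [NormedAddCommGroup K] [InnerProductSpace ℂ K] (T : H →L[ℂ] K) :
    UniformSpace.Completion (H ⊗[ℂ] H) →L[ℂ] UniformSpace.Completion (K ⊗[ℂ] K) :=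
  (TensorProduct.mapL T T).completion

section tensorSq

variable {H H' K L : Type*} [NormedAddCommGroup H] [InnerProductSpace ℂ H]
  [NormedAddCommGroup H'] [InnerProductSpace ℂ H'] [NormedAddCommGroup K] [InnerProductSpace ℂ K]
  [NormedAddCommGroup L] [InnerProductSpace ℂ L]

lemma tensorSq_coe (T : H →L[ℂ] K) (x : H ⊗[ℂ] H) :
    tensorSq T (x : UniformSpace.Completion (H ⊗[ℂ] H)) =
      (TensorProduct.mapL T T x : UniformSpace.Completion (K ⊗[ℂ] K)) :=
  ContinuousLinearMap.completion_apply_coe _ _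

lemma tensorSq_id (x : UniformSpace.Completion (H ⊗[ℂ] H)) :
    tensorSq (ContinuousLinearMap.id ℂ H) x = x := by
  induction x using UniformSpace.Completion.induction_on with
  | hp => exact isClosed_eq (by fun_prop) (by fun_prop)
  | ih x =>
    rw [tensorSq_coe]
    congr 1
    induction x with
    | zero => simp
    | add x y hx hy => rw [map_add, hx, hy]
    | tmul a b => simp

lemma tensorSq_comp (S : K →L[ℂ] L) (T : H →L[ℂ] K) (x : UniformSpace.Completion (H ⊗[ℂ] H)) :
    tensorSq (S.comp T) x = tensorSq S (tensorSq T x) := by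
  induction x using UniformSpace.Completion.induction_on with
  | hp => exact isClosed_eq (by fun_prop) (by fun_prop)
  | ih x =>
    rw [tensorSq_coe, tensorSq_coe, tensorSq_coe]
    congr 1
    induction x with
    | zero => simp
    | add x y hx hy => simp only [map_add, hx, hy]
    | tmul a b => simp

/-- On elementary tensors the inner product factors, so an identity `S⋆ T = S'⋆ T'` passes to tensor
squares, and then to the completion by linearity and continuity. With `S` the identity it transfers
both the compression formula and the representation property from `L₂` to `L₂ ⊗ L₂`, without
computing adjoints. -/
lemma inner_tensorSq_congr {S : H →L[ℂ] K} {T : H' →L[ℂ] K} {S' : H →L[ℂ] L} {T' : H' →L[ℂ] L}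
    (h : ∀ a b, ⟪S a, T b⟫_ℂ = ⟪S' a, T' b⟫_ℂ) (x : UniformSpace.Completion (H ⊗[ℂ] H))
    (y : UniformSpace.Completion (H' ⊗[ℂ] H')) :
    ⟪tensorSq S x, tensorSq T y⟫_ℂ = ⟪tensorSq S' x, tensorSq T' y⟫_ℂ := by
  induction x using UniformSpace.Completion.induction_on with
  | hp => exact isClosed_eq (by fun_prop) (by fun_prop)
  | ih x =>
    induction y using UniformSpace.Completion.induction_on with
    | hp => exact isClosed_eq (by fun_prop) (by fun_prop)
    | ih y =>
      simp only [tensorSq_coe, UniformSpace.Completion.inner_coe]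
      induction x with
      | zero => simp
      | add x y hx hy => simp only [map_add, inner_add_left, hx, hy]
      | tmul a b =>
        induction y with
        | zero => simp
        | add x y hx hy => simp only [map_add, inner_add_right, hx, hy]
        | tmul c d => simp only [TensorProduct.mapL_tmul, TensorProduct.inner_tmul, h]

end tensorSq

/-! ### The regular representation of `G` and its tensor square -/

section regular

variable {G : Type*} [TopologicalSpace G] [Group G] [IsTopologicalGroup G] [LocallyCompactSpace G]
  [MeasurableSpace G] [BorelSpace G]

/-- The left regular representation of `G` on `L₂(G)`. -/
noncomputable def groupTranslations (m : Measure G) [m.IsHaarMeasure] [m.Regular] :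
    ContractionFamily G (Lp ℂ 2 m) where
  op p := (Lp.compMeasurePreservingₗᵢ ℂ (p⁻¹ * ·)
    (measurePreserving_mul_left m p⁻¹)).toContinuousLinearMap
  norm_op_le p := LinearIsometry.norm_toContinuousLinearMap_le _
  continuous_inner ξ η := by
    have : Fact ((2 : ENNReal) ≠ ⊤) := ⟨by norm_num⟩
    -- The element `DomMulAct.mk c` acts by precomposition with `q ↦ c q`, so `c = p⁻¹` gives `λ(p)
    -- η`. The continuity of this action, for a finite exponent, yields strong continuity and hence
    -- weak continuity.
    have h : Continuous fun p : G => DomMulAct.mk p⁻¹ • η :=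
      (DomMulAct.continuous_mk.comp continuous_inv).smul continuous_const
    exact continuous_const.inner h

lemma groupTranslations_ae_eq (m : Measure G) [m.IsHaarMeasure] [m.Regular] (p : G)
    (ξ : Lp ℂ 2 m) : (groupTranslations m).op p ξ =ᵐ[m] fun q => ξ (p⁻¹ * q) :=
  Lp.coeFn_compMeasurePreserving ξ (measurePreserving_mul_left m p⁻¹)

/-- One has `λ(q) = λ(p) λ(p⁻¹q)`, and `λ(p)` preserves inner products. The coefficient at `p⁻¹q`
thus splits into a part depending on `p` and a part depending on `q`, which is the source of
positivity. -/
lemma inner_groupTranslations (m : Measure G) [m.IsHaarMeasure] [m.Regular] (p q : G)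
    (ξ η : Lp ℂ 2 m) : ⟪ξ, (groupTranslations m).op (p⁻¹ * q) η⟫_ℂ =
      ⟪(groupTranslations m).op p ξ, (groupTranslations m).op q η⟫_ℂ := by
  have h : (groupTranslations m).op q η =
      (groupTranslations m).op p ((groupTranslations m).op (p⁻¹ * q) η) := by
    refine Lp.ext ?_
    filter_upwards [groupTranslations_ae_eq m q η,
      groupTranslations_ae_eq m p ((groupTranslations m).op (p⁻¹ * q) η),
      (measurePreserving_mul_left m p⁻¹).quasiMeasurePreserving.ae
        (groupTranslations_ae_eq m (p⁻¹ * q) η)] with r h1 h2 h3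
    rw [h1, h2, h3]
    congr 1
    group
  rw [h]
  exact (LinearIsometry.inner_map_map _ _ _).symm

/-- The representation `p ↦ λ(p) ⊗ λ(p)` of `G` on `L₂(G) ⊗ L₂(G)`. -/
noncomputable def groupTranslationsSq (m : Measure G) [m.IsHaarMeasure] [m.Regular] :
    ContractionFamily G (UniformSpace.Completion (Lp ℂ 2 m ⊗[ℂ] Lp ℂ 2 m)) :=
  ((groupTranslations m).tensor (groupTranslations m)).comap ⟨fun p => (p, p), by fun_prop⟩

/-- The splitting survives the passage to `λ(p) ⊗ λ(p)` because group translations multiply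
pointwise. The translations of `Q` have no such property in general, as the convolution of two point
masses need not be a point mass. -/
lemma inner_groupTranslationsSq (m : Measure G) [m.IsHaarMeasure] [m.Regular] (p q : G)
    (ξ η : UniformSpace.Completion (Lp ℂ 2 m ⊗[ℂ] Lp ℂ 2 m)) :
    ⟪ξ, (groupTranslationsSq m).op (p⁻¹ * q) η⟫_ℂ =
      ⟪(groupTranslationsSq m).op p ξ, (groupTranslationsSq m).op q η⟫_ℂ := by
  have h := inner_tensorSq_congr (S := ContinuousLinearMap.id ℂ (Lp ℂ 2 m))
    (fun a b => inner_groupTranslations m p q a b) ξ η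
  rwa [tensorSq_id] at h

end regular

/-! ### Comparison of `Q` with `G` -/

namespace HypergroupExpectation

variable {G : Type*} [TopologicalSpace G] [Group G] [IsTopologicalGroup G]
  [LocallyCompactSpace G] [T2Space G] [MeasurableSpace G] [BorelSpace G]

/-- The isometry `f ↦ f ∘ φ` of `L₂(Q)` into `L₂(G)`. -/
noncomputable def pullback (E : HypergroupExpectation G) (m : Measure G) :
    E.L2 m →ₗᵢ[ℂ] Lp ℂ 2 m :=
  Lp.compMeasurePreservingₗᵢ ℂ E.φ (E.measurePreserving_φ m)

lemma pullback_incl_ae_eq (E : HypergroupExpectation G) (m : Measure G)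
    [IsFiniteMeasureOnCompacts m] (f : E.𝒦) :
    E.pullback m (E.incl m f) =ᵐ[m] fun p => f.1 (E.φ p) :=
  (Lp.coeFn_compMeasurePreserving (E.incl m f) (E.measurePreserving_φ m)).trans
    ((E.measurePreserving_φ m).quasiMeasurePreserving.ae_eq_comp
      (MemLp.coeFn_toLp (f.1.continuous.memLp_of_hasCompactSupport (p := 2) f.2)))

/-- `λ_Q(ε_{φ(p)})` is the compression of the left translation by `p` on `L₂(G)`. -/
lemma inner_translation (E : HypergroupExpectation G) {m : Measure G} [m.IsHaarMeasure]
    [m.Regular] (hm : E.Preserves m) (p : G) (a b : E.L2 m) :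
    ⟪a, E.translation m (E.φ p) b⟫_ℂ =
      ⟪E.pullback m a, (groupTranslations m).op p (E.pullback m b)⟫_ℂ := by
  have hd := E.denseRange_incl m
  -- Both sides are continuous in `a` and `b`, so vectors from `𝒦(Q)` suffice. There the claim is
  -- the symmetry of `P`, tested against the translate by `p` of the lifted function.
  induction a, b using hd.induction_on₂ with
  | hp => exact isClosed_eq (by fun_prop) (by fun_prop)
  | h f g =>
    have h1 : E.translation m (E.φ p) (E.incl m g) = E.incl m (E.translate (E.φ p) g) :=
      LinearMap.extendOfNorm_eq hd ⟨1, E.norm_translate_le hm (E.φ p)⟩ g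
    -- The symmetry of `P` is stated for the bilinear pairing, so the left vector enters through its
    -- complex conjugate.
    obtain ⟨k, hk⟩ := E.exists_𝒦 (g := fun s => star (f.1 s)) (by fun_prop)
      (HasCompactSupport.comp_left (g := star) f.2 (star_zero _))
    have h2 := E.integral_map_mul_lift hm (sliceRight (comul (E.lift g.1)) p⁻¹) k
    rw [h1, ← LinearIsometry.inner_map_map (E.pullback m), L2.inner_def, L2.inner_def]
    refine Eq.trans (integral_congr_ae ?_) (h2.trans (integral_congr_ae ?_))
    · filter_upwards [E.pullback_incl_ae_eq m f,
        E.pullback_incl_ae_eq m (E.translate (E.φ p) g)] with q e1 e2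
      rw [e1, e2, translate_apply, inv_φ, comulQ_φ', E.map_lift, hk]
      simp
    · filter_upwards [E.pullback_incl_ae_eq m f,
        groupTranslations_ae_eq m p (E.pullback m (E.incl m g)),
        (measurePreserving_mul_left m p⁻¹).quasiMeasurePreserving.ae
          (E.pullback_incl_ae_eq m g)] with q e1 e2 e3
      rw [e1, e2, e3, hk]
      simp [sliceRight, comul, lift]

/-- The convolution of elements of `L₁(m̃)`, in terms of the group. -/
lemma star_mul_apply (E : HypergroupExpectation G) {m : Measure G} [m.Regular]
    (hm : E.Preserves m) {μ ν : Mb E.Q} {f h : E.Q → ℂ}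
    (hf : Integrable f (E.mQ m)) (hh : Integrable h (E.mQ m))
    (hμ : ∀ g : E.Q →ᵇ ℂ, μ.1 g = ∫ t, g t * f t ∂(E.mQ m))
    (hν : ∀ g : E.Q →ᵇ ℂ, ν.1 g = ∫ t, g t * h t ∂(E.mQ m)) (c : E.Q →ᵇ ℂ) :
    (star μ * ν).1 c =
      star (∫ p, star (∫ q, c (E.φ (p⁻¹ * q)) * h (E.φ q) ∂m) * f (E.φ p) ∂m) := by
  rw [mul_apply_apply, Mb.tensor_apply, star_apply_apply, hμ,
    E.integral_mQ m (integrable_bcf_mul _ hf).aestronglyMeasurable]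
  congr 2
  ext p
  congr 1
  change star (ν.1 (sliceRight (E.comulQ c) (E.inv (E.φ p)))) = _
  congr 1
  rw [hν, E.integral_mQ m (integrable_bcf_mul _ hh).aestronglyMeasurable, inv_φ]
  -- Of the two averagings in `(P × P) Δ`, the compatibility with `Δ` leaves one outside and one on
  -- `c ∘ φ`; the latter disappears because `c ∘ φ` is fixed. The remaining `P` is then removed by
  -- integrating against `h ∘ φ`.
  have h1 : ∀ q, sliceRight (E.comulQ c) (E.φ p⁻¹) (E.φ q) =
      E.P (sliceRight (comul (E.lift c)) p⁻¹) q := by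
    intro q
    change E.comulQ c (E.φ p⁻¹, E.φ q) = _
    rw [E.comulQ_φ', E.map_lift]
  simp only [h1]
  exact E.integral_map_mul hm _ hh

/-- The operator `∫ f(φ(p)) (λ(p) ⊗ λ(p)) dm(p)`, restricted to `L₂(Q) ⊗ L₂(Q)`. -/
noncomputable def convOp (E : HypergroupExpectation G) {m : Measure G} [m.IsHaarMeasure]
    [m.Regular] {f : E.Q → ℂ} (hf : Integrable f (E.mQ m)) :
    E.L2Tensor m →L[ℂ] UniformSpace.Completion (Lp ℂ 2 m ⊗[ℂ] Lp ℂ 2 m) :=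
  ((groupTranslationsSq m).integral (Mb.ofIntegrable m
    ((E.measurePreserving_φ m).integrable_comp_of_integrable hf))).comp
      (tensorSq (E.pullback m).toContinuousLinearMap)

lemma inner_convOp (E : HypergroupExpectation G) {m : Measure G} [m.IsHaarMeasure]
    [m.Regular] {f : E.Q → ℂ} (hf : Integrable f (E.mQ m))
    (ξ : UniformSpace.Completion (Lp ℂ 2 m ⊗[ℂ] Lp ℂ 2 m)) (x : E.L2Tensor m) :
    ⟪ξ, E.convOp hf x⟫_ℂ = ∫ p, ⟪ξ, (groupTranslationsSq m).op p
      (tensorSq (E.pullback m).toContinuousLinearMap x)⟫_ℂ * f (E.φ p) ∂m :=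
  ContractionFamily.inner_integral _ _ _ _

/-- Convolution and involution turn into an inner product: the diagonal coefficient of `λ_Q ⊗ λ_Q`
at `φ(p⁻¹q)` is a coefficient of the group representation, which splits over `p` and `q`, and the
double integral separates accordingly. -/
lemma inner_leftRegularTensor_δ (E : HypergroupExpectation G) {m : Measure G} [m.IsHaarMeasure]
    [m.Regular] (hm : E.Preserves m) {μ ν : Mb E.Q} {f h : E.Q → ℂ}
    (hf : Integrable f (E.mQ m)) (hh : Integrable h (E.mQ m))
    (hμ : ∀ g : E.Q →ᵇ ℂ, μ.1 g = ∫ t, g t * f t ∂(E.mQ m))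
    (hν : ∀ g : E.Q →ᵇ ℂ, ν.1 g = ∫ t, g t * h t ∂(E.mQ m)) (x y : E.L2Tensor m) :
    ⟪x, E.leftRegularTensor m hm (Mb.δ E.Q (star μ * ν)) y⟫_ℂ =
      ⟪E.convOp hf x, E.convOp hh y⟫_ℂ := by
  let c : E.Q →ᵇ ℂ :=
    (((E.translations m hm).tensor (E.translations m hm)).coeff x y).compContinuous
      ⟨fun s => (s, s), by fun_prop⟩
  have hcφ : ∀ p, c (E.φ p) = ⟪tensorSq (E.pullback m).toContinuousLinearMap x,
      (groupTranslationsSq m).op p (tensorSq (E.pullback m).toContinuousLinearMap y)⟫_ℂ := by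
    intro p
    -- This is the tensor square of `λ_Q(ε_{φ(p)}) = V⋆ λ(p) V`, where `V` is `E.pullback m`.
    have h1 := inner_tensorSq_congr (S := ContinuousLinearMap.id ℂ (E.L2 m))
      (T := E.translation m (E.φ p)) (S' := (E.pullback m).toContinuousLinearMap)
      (T' := ((groupTranslations m).op p).comp (E.pullback m).toContinuousLinearMap)
      (fun a b => E.inner_translation hm p a b) x y
    rw [tensorSq_id, tensorSq_comp] at h1
    exact h1
  rw [leftRegularTensor, ContractionFamily.inner_integral]
  change (star μ * ν).1 c = _
  -- `inner_convOp` integrates only in the second slot of the inner product. Conjugating makes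
  -- `E.convOp hf x` the second slot for the integral over `p`; a second conjugation below does the
  -- same for `q`, matching the two nested conjugates of `star_mul_apply`.
  rw [E.star_mul_apply hm hf hh hμ hν, ← inner_conj_symm, inner_convOp]
  congr 2
  ext p
  congr 1
  rw [← inner_conj_symm, inner_convOp]
  simp only [hcφ, inner_groupTranslationsSq]
  rfl

end HypergroupExpectation
end ExpectationHypergroup

/-! ### Complete positivity -/

theorem mainTheorem2 {G : Type*} [TopologicalSpace G] [Group G] [IsTopologicalGroup G]
    [LocallyCompactSpace G] [T2Space G] [MeasurableSpace G] [BorelSpace G]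
    (m : MeasureTheory.Measure G) [m.IsHaarMeasure] [m.Regular]
    (E : ExpectationHypergroup.HypergroupExpectation G) (hm : E.Preserves m) :
    ExpectationHypergroup.IsCompletelyPositiveOn (𝓑 := ExpectationHypergroup.Mb E.Q)
      (A := E.L2Tensor m →L[ℂ] E.L2Tensor m)
      (E.leftRegularTensor m hm ∘ₗ ExpectationHypergroup.Mb.δ E.Q) (E.L1 m) := by
  intro n M hM
  choose f hf hfM using hM
  -- The `(i, j)` entry of `M⋆ M` is the sum over `k` of `(M k i)⋆ * M k j`, so the Gram family
  -- attaches to `(k, i)` the operator given by the density of `M k i`.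
  refine CStarMatrix.nonneg_of_gram _ (fun k i => E.convOp (hf k i)) fun i j x y => ?_
  rw [CStarMatrix.map_apply, CStarMatrix.mul_apply, map_sum, sum_apply, inner_sum]
  exact Finset.sum_congr rfl fun k _ =>
    E.inner_leftRegularTensor_δ hm (hf k i) (hf k j) (hfM k i) (hfM k j) x y
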